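/- Let $A=\{a_1,\dots,a_n\}$ be a finite set of vectors in $\mathbb{Z}^d$ that generates $\mathbb{Z}^d$ as an abelian group, let $\mathbb{N}A\subseteq\mathbb{Z}^d$ be the monoid generated by $A$, and let $R_A=\mathbb{C}[\mathbb{N}A]$ be its semigroup algebra, regarded as a module over $R=\mathbb{C}[x_1,\dots,x_n]$ via $x_j\mapsto t^{a_j}$. Let $D(R_A)=\bigcup_{k\ge 0}D^k(R_A)\subseteq\mathrm{End}_{\mathbb{C}}(R_A)$ be the algebra of differential operators on $R_A$, where $D^0(R_A)=\mathrm{Hom}_R(R_A,R_A)$ and $D^{k+1}(R_A)=\{P\in\mathrm{End}_{\mathbb{C}}(R_A): [f,P]\in D^k(R_A)\text{ for all }f\in R\}$. Let $\mathcal{F}$ be the set of facets (maximal proper faces) of the cone $\mathbb{R}_{\ge 0}A\subseteq\mathbb{R}^d$. For $\sigma\in\mathcal{F}$ let $F_\sigma$ be the primitive integral support function of $\sigma$, i.e. the unique linear form on $\mathbb{R}^d$ with $F_\sigma(\mathbb{R}_{\ge 0}A)\ge 0$, $F_\sigma(\sigma)=0$ and $F_\sigma(\mathbb{Z}^d)=\mathbb{Z}$;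 its $\mathbb{C}$-linear extension to $\mathbb{C}^d$ is also denoted by $F_\sigma$. The semigroup $\mathbb{N}A$ is called scored if $$\mathbb{N}A=\bigcap_{\sigma\in\mathcal{F}}\{a\in\mathbb{Z}^d: F_\sigma(a)\in F_\sigma(\mathbb{N}A)\}.$$ For $\alpha\in\mathbb{C}^d$ put $\mathcal{F}_+(\alpha)=\{\sigma\in\mathcal{F}: F_\sigma(\alpha)\in F_\sigma(\mathbb{N}A)\}$, $\mathcal{F}_-(\alpha)=\{\sigma\in\mathcal{F}: F_\sigma(\alpha)\in\mathbb{Z}\setminus F_\sigma(\mathbb{N}A)\}$, and $$\mathbb{R}_{>0}(\alpha)=\{\gamma\in\mathbb{R}^d: F_\sigma(\gamma)>0\ (\sigma\in\mathcal{F}_+(\alpha)),\ F_\sigma(\gamma)<0\ (\sigma\in\mathcal{F}_-(\alpha))\}.$$ Theorem. The algebra $D(R_A)$ is simple if and only if the semigroup $\mathbb{N}A$ is scored and the following condition holds: (C2) for every $\alpha\in\mathbb{C}^d$, the set $\mathbb{R}_{>0}(\alpha)$ is nonempty. -/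

import Mathlib

namespace AffineToric

/-! ### Differential operators on a module -/

section DiffOp

variable (k R M : Type*) [CommRing k] [CommRing R] [Algebra k R] [AddCommGroup M]
  [Module k M] [Module R M] [IsScalarTower k R M]

/-- The commutator `[f, P]` of (multiplication by) `f ∈ R` and `P ∈ Hom_k(M, M)`. -/
def comm (f : R) (P : Module.End k M) : Module.End k M :=
  Algebra.lsmul k k M f * P - P * Algebra.lsmul k k M f

/-- `IsDiffOp k R M m P` says that `P` lies in `D^m(M, M)`, i.e. `P` is a `k`-linear differential
operator of order at most `m` on the `R`-module `M`: `D^0(M, M) = Hom_R(M, M)` and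
`D^{m+1}(M, M) = {P : [f, P] ∈ D^m(M, M) for all f ∈ R}`. -/
def IsDiffOp : ℕ → Module.End k M → Prop
  | 0, P => ∀ (f : R) (x : M), P (f • x) = f • P x
  | m + 1, P => ∀ f : R, IsDiffOp m (comm k R M f P)

variable {k R M}

theorem comm_apply (f : R) (P : Module.End k M) (x : M) :
    comm k R M f P x = f • P x - P (f • x) := by
  simp [comm]

theorem comm_add (f : R) (P Q : Module.End k M) :
    comm k R M f (P + Q) = comm k R M f P + comm k R M f Q := by
  simp only [comm, mul_add, add_mul]; abel

theorem comm_mul (f : R) (P Q : Module.End k M) :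
    comm k R M f (P * Q) = comm k R M f P * Q + P * comm k R M f Q := by
  simp only [comm, mul_sub, sub_mul, mul_assoc]; abel

theorem comm_eq_zero {P : Module.End k M} (h : IsDiffOp k R M 0 P) (f : R) :
    comm k R M f P = 0 := by
  ext x
  simp [comm_apply, h f x]

theorem isDiffOp_zero (m : ℕ) : IsDiffOp k R M m 0 := by
  induction m with
  | zero => intro f x; simp
  | succ m ih => intro f; simpa [comm] using ih

theorem IsDiffOp.add {m : ℕ} {P Q : Module.End k M} (hP : IsDiffOp k R M m P)
    (hQ : IsDiffOp k R M m Q) : IsDiffOp k R M m (P + Q) := by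
  induction m generalizing P Q with
  | zero => intro f x; simp [hP f x, hQ f x]
  | succ m ih => intro f; rw [comm_add]; exact ih (hP f) (hQ f)

theorem IsDiffOp.succ {m : ℕ} {P : Module.End k M} (hP : IsDiffOp k R M m P) :
    IsDiffOp k R M (m + 1) P := by
  induction m generalizing P with
  | zero => intro f; rw [comm_eq_zero hP]; exact isDiffOp_zero 0
  | succ m ih => intro f; exact ih (hP f)

theorem IsDiffOp.mono {m n : ℕ} (h : m ≤ n) {P : Module.End k M} (hP : IsDiffOp k R M m P) :
    IsDiffOp k R M n P := by
  induction h with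
  | refl => exact hP
  | step _ ih => exact ih.succ

theorem IsDiffOp.mul {m n : ℕ} {P Q : Module.End k M} (hP : IsDiffOp k R M m P)
    (hQ : IsDiffOp k R M n Q) : IsDiffOp k R M (m + n) (P * Q) := by
  obtain ⟨s, hs⟩ : ∃ s, s = m + n := ⟨_, rfl⟩
  induction s generalizing m n P Q with
  | zero =>
    obtain ⟨rfl, rfl⟩ : m = 0 ∧ n = 0 := by omega
    intro f x
    simp [hQ f x, hP f]
  | succ s ih =>
    rw [← hs]
    intro f
    rw [comm_mul]
    refine IsDiffOp.add ?_ ?_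
    · cases m with
      | zero => rw [comm_eq_zero hP, zero_mul]; exact isDiffOp_zero s
      | succ m =>
        have hmn : s = m + n := by omega
        rw [hmn]
        exact ih (hP f) hQ hmn
    · cases n with
      | zero => rw [comm_eq_zero hQ, mul_zero]; exact isDiffOp_zero s
      | succ n =>
        have hmn : s = m + n := by omega
        rw [hmn]
        exact ih hP (hQ f) hmn

theorem isDiffOp_algebraMap (c : k) :
    IsDiffOp k R M 0 (algebraMap k (Module.End k M) c) := by
  intro f x
  simp only [Module.algebraMap_end_apply]
  exact smul_comm c f x

variable (k R M)

/-- The algebra `D(M) = ⋃_m D^m(M, M)` of `k`-linear differential operators on the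
`R`-module `M`; the product is composition. -/
def diffOps : Subalgebra k (Module.End k M) where
  carrier := {P | ∃ m, IsDiffOp k R M m P}
  mul_mem' := fun ⟨_, hP⟩ ⟨_, hQ⟩ => ⟨_, hP.mul hQ⟩
  add_mem' := fun ⟨_, hP⟩ ⟨_, hQ⟩ =>
    ⟨_, (hP.mono (le_max_left _ _)).add (hQ.mono (le_max_right _ _))⟩
  algebraMap_mem' := fun c => ⟨0, isDiffOp_algebraMap c⟩

end DiffOp

/-! ### The semigroup algebra -/

section Semigroup

variable {d n : ℕ} (A : Fin n → Fin d → ℤ)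

/-- The monoid `ℕA` generated by the vectors `a_1, …, a_n ∈ ℤ^d`. -/
abbrev NA : AddSubmonoid (Fin d → ℤ) := AddSubmonoid.closure (Set.range A)

/-- The semigroup algebra `R_A = ℂ[ℕA]`. -/
abbrev RA : Type := AddMonoidAlgebra ℂ (NA A)

/-- The surjection `ℂ[x_1, …, x_n] → R_A`, `x_j ↦ t^{a_j}`. -/
noncomputable def toRA : MvPolynomial (Fin n) ℂ →ₐ[ℂ] RA A :=
  MvPolynomial.aeval fun j =>
    AddMonoidAlgebra.single
      (⟨A j, AddSubmonoid.subset_closure (Set.mem_range_self j)⟩ : NA A) (1 : ℂ)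

/-- `R_A` as an algebra, hence as a module, over `R = ℂ[x_1, …, x_n]`. -/
noncomputable instance instAlgebraRA : Algebra (MvPolynomial (Fin n) ℂ) (RA A) :=
  (toRA A).toAlgebra

instance instIsScalarTowerRA : IsScalarTower ℂ (MvPolynomial (Fin n) ℂ) (RA A) :=
  IsScalarTower.of_algHom (toRA A)

/-- The algebra `D(R_A)` of differential operators on the `ℂ[x_1, …, x_n]`-module `R_A`. -/
noncomputable abbrev DRA : Subalgebra ℂ (Module.End ℂ (RA A)) :=
  diffOps ℂ (MvPolynomial (Fin n) ℂ) (RA A)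

/-! ### Facets and their primitive integral support functions -/

/-- The inclusion `ℤ^d → ℝ^d`. -/
def toReal (a : Fin d → ℤ) : Fin d → ℝ := fun i => (a i : ℝ)

/-- The cone `ℝ_{≥0}A` in `ℝ^d`. -/
noncomputable def cone : PointedCone ℝ (Fin d → ℝ) :=
  PointedCone.hull ℝ (Set.range fun j => toReal (A j))

/-- A facet of `ℝ_{≥0}A` is a maximal proper face. -/
def IsFacet (σ : PointedCone ℝ (Fin d → ℝ)) : Prop :=
  Maximal (fun τ : PointedCone ℝ (Fin d → ℝ) => τ.IsFaceOf (cone A) ∧ τ ≠ cone A) σ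

/-- The type `ℱ` of facets of the cone `ℝ_{≥0}A`. -/
abbrev Facet : Type := {σ : PointedCone ℝ (Fin d → ℝ) // IsFacet A σ}

/-- The defining properties of the primitive integral support function of `σ`:
`F(ℝ_{≥0}A) ≥ 0`, `F(σ) = 0` and `F(ℤ^d) = ℤ`. -/
structure IsPrimitiveSupport (σ : PointedCone ℝ (Fin d → ℝ))
    (F : (Fin d → ℝ) →ₗ[ℝ] ℝ) : Prop where
  nonneg : ∀ x ∈ cone A, 0 ≤ F x
  eq_zero : ∀ x ∈ σ, F x = 0
  image_lattice : Set.range (fun a : Fin d → ℤ => F (toReal a)) = Set.range ((↑) : ℤ → ℝ)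

/-- The primitive integral support function `F_σ` of a facet `σ`: the linear form on `ℝ^d`
with the properties `IsPrimitiveSupport` (it exists and is unique when `ℤA = ℤ^d`). -/
noncomputable def supp (σ : Facet A) : (Fin d → ℝ) →ₗ[ℝ] ℝ :=
  Classical.epsilon (IsPrimitiveSupport A σ.1)

/-- The `ℂ`-linear extension of `F_σ` to `ℂ^d`. -/
noncomputable def suppC (σ : Facet A) (α : Fin d → ℂ) : ℂ :=
  ∑ i, α i * (supp A σ (Pi.single i 1) : ℂ)

/-- The set `F_σ(ℕA)` of real numbers. -/
def valuesNA (σ : Facet A) : Set ℝ :=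
  (fun a : Fin d → ℤ => supp A σ (toReal a)) '' (NA A : Set (Fin d → ℤ))

/-! ### Scored semigroups and condition (C2) -/

/-- `ℕA` is scored: `ℕA = ⋂_σ {a ∈ ℤ^d : F_σ(a) ∈ F_σ(ℕA)}`, over all facets `σ`. -/
def IsScored : Prop :=
  (NA A : Set (Fin d → ℤ)) = ⋂ σ : Facet A, {a | supp A σ (toReal a) ∈ valuesNA A σ}

/-- `ℱ_+(α) = {σ : F_σ(α) ∈ F_σ(ℕA)}`. -/
def facetsPos (α : Fin d → ℂ) : Set (Facet A) :=
  {σ | suppC A σ α ∈ ((↑) : ℝ → ℂ) '' valuesNA A σ}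

/-- `ℱ_-(α) = {σ : F_σ(α) ∈ ℤ ∖ F_σ(ℕA)}`. -/
def facetsNeg (α : Fin d → ℂ) : Set (Facet A) :=
  {σ | suppC A σ α ∈ Set.range ((↑) : ℤ → ℂ) \ ((↑) : ℝ → ℂ) '' valuesNA A σ}

/-- The region `ℝ_{>0}(α)` of all `γ ∈ ℝ^d` with `F_σ(γ) > 0` for `σ ∈ ℱ_+(α)` and
`F_σ(γ) < 0` for `σ ∈ ℱ_-(α)`. -/
def posRegion (α : Fin d → ℂ) : Set (Fin d → ℝ) :=
  {γ | (∀ σ ∈ facetsPos A α, 0 < supp A σ γ) ∧ ∀ σ ∈ facetsNeg A α, supp A σ γ < 0}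

/-- Condition (C2): the region `ℝ_{>0}(α)` is nonempty for every `α ∈ ℂ^d`. -/
def ConditionC2 : Prop :=
  ∀ α : Fin d → ℂ, (posRegion A α).Nonempty

end Semigroup

end AffineToric

/-!
Write `S = ℕA`, and `θ_i` for the operator `t^b ↦ b_i t^b`.

A differential operator on `R_A` is a finite sum of components `t^a p_a(θ) : t^b ↦ p_a(b) t^{a+b}`,
where the polynomial `p_a`, the symbol of degree `a`, vanishes at those `b ∈ S` with `a + b ∉ S`
(`eval_symb`, `finite_symb`, `eval_symb_eq_zero`). Indeed commutators with monomials take differences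
of the matrix coefficients, so these are polynomial functions on `S`, and a polynomial function on
`S` extends to `ℂ^d` (`IsPolyFun.exists_mvPolynomial`). Conversely each such `t^a p(θ)` is a
differential operator (`tOp_mem`). Symbols can be evaluated at any `β ∈ ℂ^d`, as if `t^a p_a(θ)`
acted by `t^β ↦ p_a(β) t^{β+a}`. Since `S ∩ σ` is Zariski dense in the hyperplane of the facet `σ`
(`eval_eq_zero_of_facet`), an operator can lead from `β` to `β + a` only if
`ℱ_+(β) ⊆ ℱ_+(β + a)` (`facetsPos_subset_of_eval_symb_ne_zero`).

If `D(R_A)` is simple, no nonzero operator kills a nonzero subquotient of such a module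
(`not_isSimpleRing_of_isOpConvex`). The lattice points of the scored closure of `S` outside `S` give
a subquotient killed by a monomial in the conductor of `S`, so `S` is scored. The exponents in
`α + ℤ^d` with the same `ℱ_+` as `α` give another one. On these each `F_σ` that is integral at `α`
is bounded on one side. If the region of `α` is empty, some such `F_σ` takes finitely many values
there (`exists_suppZ_bounded`), and the product of the corresponding `F_σ(θ) - v` kills the
subquotient; hence (C2).

Conversely let `S` be scored and assume (C2). A nonzero two-sided ideal `J` contains a nonzero
element of `R_A`, by taking commutators with `R_A`, and then a monomial `t^c`, by taking commutators
with the `θ_i` (`exists_inIdeal_mulOp`, `exists_inIdeal_mon`). As `S` is scored, `D(R_A)` contains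
in each degree `b` the operator whose symbol is the product of the `F_σ - m` over the finitely many
`m ∈ F_σ(S)` with `m + F_σ(b) ∉ F_σ(S)` (`exitPoly`). Given `α ∈ ℂ^d`, choose `b` deep inside the
region of `α`: applying the operator of degree `b`, multiplying by `t^c` and applying the operator of
degree `-(b + c)` gives an element `p(θ)` of `J` with `p(α) ≠ 0` (`exists_exitPoly_ne_zero`). By the
Nullstellensatz `1 ∈ J`.

The facts on cones come from Farkas' lemma: every facet is the zero set of a form whose kernel is
spanned by elements of `A`, and the cone is cut out by these forms (`IsFacet.exists_extremal`,
`mem_span_of_supp_eq_zero`, `mem_cone_of_supp_nonneg`).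
-/

namespace AffineToric

/-! ### Finitely generated cones and their supporting forms -/

section Cone

variable {V ι : Type*} [AddCommGroup V] [Module ℝ V]

/-- Farkas' lemma. If `F` separates `x` from the cone of the generators other than `f i` but is
negative at `f i`, project along `f i` onto the kernel of `F` and use induction. -/
theorem farkas (s : Finset ι) (f : ι → V) (x : V) :
    (∃ r : ι → ℝ, (∀ j, 0 ≤ r j) ∧ x = ∑ j ∈ s, r j • f j) ∨
      ∃ F : V →ₗ[ℝ] ℝ, (∀ j ∈ s, 0 ≤ F (f j)) ∧ F x < 0 := by
  classical
  induction s using Finset.induction_on generalizing f x with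
  | empty =>
    by_cases hx : x = 0
    · exact Or.inl ⟨0, by simp, by simp [hx]⟩
    · right
      obtain ⟨F, hF⟩ : ∃ F : V →ₗ[ℝ] ℝ, F x ≠ 0 := by
        by_contra! h
        exact hx ((Module.forall_dual_apply_eq_zero_iff ℝ x).1 h)
      rcases lt_or_gt_of_ne hF with h | h
      · exact ⟨F, by simp, h⟩
      · exact ⟨-F, by simp, by simpa using h⟩
  | insert i s hi ih =>
    rcases ih f x with ⟨r, hr, hx⟩ | ⟨F, hF, hFx⟩
    · refine Or.inl ⟨Function.update r i 0, fun j => ?_, ?_⟩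
      · by_cases h : j = i
        · subst h; simp
        · simp [h, hr]
      · rw [Finset.sum_insert hi, hx]
        simp only [Function.update_self, zero_smul, zero_add]
        refine Finset.sum_congr rfl fun j hj => ?_
        rw [Function.update_of_ne]
        rintro rfl; exact hi hj
    · by_cases hFi : 0 ≤ F (f i)
      · exact Or.inr ⟨F, by simpa [hFi] using hF, hFx⟩
      push Not at hFi
      let π : V →ₗ[ℝ] V := LinearMap.id - (F (f i))⁻¹ • F.smulRight (f i)
      have hπ : ∀ v, π v = v - ((F (f i))⁻¹ * F v) • f i := fun v => by
        simp [π, mul_smul]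
      rcases ih (fun j => π (f j)) (π x) with ⟨r, hr, hx⟩ | ⟨G, hG, hGx⟩
      · left
        refine ⟨Function.update r i
          ((F (f i))⁻¹ * F x - ∑ j ∈ s, r j * ((F (f i))⁻¹ * F (f j))), fun j => ?_, ?_⟩
        · by_cases h : j = i
          · subst h
            simp only [Function.update_self, sub_nonneg]
            refine le_trans (Finset.sum_nonpos fun k hk => ?_)
              (mul_nonneg_of_nonpos_of_nonpos (inv_nonpos.2 hFi.le) hFx.le)
            exact mul_nonpos_of_nonneg_of_nonpos (hr k)
              (mul_nonpos_of_nonpos_of_nonneg (inv_nonpos.2 hFi.le) (hF k hk))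
          · simp [h, hr]
        · rw [Finset.sum_insert hi, Function.update_self]
          have h1 : ∑ j ∈ s, Function.update r i
              ((F (f i))⁻¹ * F x - ∑ j ∈ s, r j * ((F (f i))⁻¹ * F (f j))) j • f j
              = ∑ j ∈ s, r j • f j := by
            refine Finset.sum_congr rfl fun j hj => ?_
            rw [Function.update_of_ne]
            rintro rfl; exact hi hj
          rw [h1, sub_smul, Finset.sum_smul]
          simp only [hπ, smul_sub, Finset.sum_sub_distrib, smul_smul] at hx
          rw [sub_eq_iff_eq_add] at hx
          exact hx.trans (by abel)
      · right
        refine ⟨G ∘ₗ π, fun j hj => ?_, hGx⟩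
        rcases Finset.mem_insert.1 hj with rfl | hj
        · simp [hπ, inv_mul_cancel₀ hFi.ne]
        · exact hG j hj

/-- A form that is nonnegative on a spanning family `f` and negative at `x` can be rotated, keeping
its value at `x` and its zeros among the `f j`, until its kernel is spanned by these zeros. -/
theorem exists_extremal_form [Finite ι] (f : ι → V) (hspan : Submodule.span ℝ (Set.range f) = ⊤)
    (x : V) (F : V →ₗ[ℝ] ℝ) (hF : ∀ j, 0 ≤ F (f j)) (hx : F x < 0) :
    ∃ F' : V →ₗ[ℝ] ℝ, (∀ j, 0 ≤ F' (f j)) ∧ F' x < 0 ∧ (∀ j, F (f j) = 0 → F' (f j) = 0) ∧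
      LinearMap.ker F' ≤ Submodule.span ℝ (f '' {j | F' (f j) = 0}) := by
  classical
  cases nonempty_fintype ι
  induction hN : (Finset.univ.filter fun j => F (f j) ≠ 0).card using Nat.strong_induction_on
    generalizing F with
  | _ N ih =>
  by_cases hker : LinearMap.ker F ≤ Submodule.span ℝ (f '' {j | F (f j) = 0})
  · exact ⟨F, hF, hx, fun _ h => h, hker⟩
  obtain ⟨y, hy, hyW⟩ := SetLike.not_le_iff_exists.1 hker
  obtain ⟨G₀, hG₀y, hG₀⟩ := Submodule.exists_le_ker_of_notMem hyW
  obtain ⟨G, hGx, hGW, j₁, hj₁⟩ : ∃ G : V →ₗ[ℝ] ℝ, G x = 0 ∧ (∀ j, F (f j) = 0 → G (f j) = 0) ∧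
      ∃ j, G (f j) < 0 := by
    let G₁ : V →ₗ[ℝ] ℝ := G₀ - (G₀ x / F x) • F
    have h1 : G₁ x = 0 := by simp [G₁, div_mul_cancel₀ _ hx.ne]
    have h2 : ∀ j, F (f j) = 0 → G₁ (f j) = 0 := fun j hj => by
      have : G₀ (f j) = 0 := hG₀ (Submodule.subset_span ⟨j, hj, rfl⟩)
      simp [G₁, hj, this]
    obtain ⟨j, hj⟩ : ∃ j, G₁ (f j) ≠ 0 := by
      by_contra! h
      have : G₁ = 0 := LinearMap.ext_on hspan (by rintro _ ⟨j, rfl⟩; simpa using h j)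
      have h3 : G₁ y = 0 := by rw [this]; rfl
      have hy' : F y = 0 := hy
      simp only [G₁, LinearMap.sub_apply, LinearMap.smul_apply, hy', smul_zero, sub_zero] at h3
      exact hG₀y h3
    rcases lt_or_gt_of_ne hj with h | h
    · exact ⟨G₁, h1, h2, j, h⟩
    · exact ⟨-G₁, by simp [h1], fun j hj => by simp [h2 j hj], j, by simpa using h⟩
  obtain ⟨j₀, hj₀, hmin⟩ := Finset.exists_min_image (Finset.univ.filter fun j => G (f j) < 0)
    (fun j => F (f j) / -G (f j)) ⟨j₁, by simpa using hj₁⟩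
  replace hj₀ : G (f j₀) < 0 := by simpa using hj₀
  set t := F (f j₀) / -G (f j₀) with ht
  have ht0 : 0 ≤ t := div_nonneg (hF _) (by linarith)
  have hF'0 : (F + t • G) (f j₀) = 0 := by
    have : G (f j₀) ≠ 0 := hj₀.ne
    simp only [LinearMap.add_apply, LinearMap.smul_apply, smul_eq_mul, ht]
    field_simp
    ring
  have hzero : ∀ j, F (f j) = 0 → (F + t • G) (f j) = 0 := fun j hj => by
    simp [hj, hGW j hj]
  have hcard : (Finset.univ.filter fun j => (F + t • G) (f j) ≠ 0).card < N := by
    rw [← hN]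
    refine Finset.card_lt_card ⟨fun j hj => ?_, fun h => ?_⟩
    · simp only [Finset.mem_filter, Finset.mem_univ, true_and] at hj ⊢
      exact fun h => hj (hzero j h)
    · have : j₀ ∈ Finset.univ.filter fun j => F (f j) ≠ 0 := by
        simp only [Finset.mem_filter, Finset.mem_univ, true_and]
        exact fun h => hj₀.ne (hGW _ h)
      have := h this
      simp only [Finset.mem_filter, Finset.mem_univ, true_and] at this
      exact this hF'0
  have hpos : ∀ j, 0 ≤ (F + t • G) (f j) := fun j => by
    by_cases hj : G (f j) < 0
    · have := hmin j (by simpa using hj)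
      rw [le_div_iff₀ (by linarith)] at this
      simp only [LinearMap.add_apply, LinearMap.smul_apply, smul_eq_mul]
      linarith
    · push Not at hj
      simpa using add_nonneg (hF j) (mul_nonneg ht0 hj)
  obtain ⟨F', h1, h2, h3, h4⟩ := ih _ hcard (F + t • G) hpos (by simpa [hGx] using hx) rfl
  exact ⟨F', h1, h2, fun j hj => h3 j (hzero j hj), h4⟩

end Cone

/-! ### Facets of the cone and their primitive integral support functions -/

section Facets

variable {d n : ℕ} {A : Fin n → Fin d → ℤ}

@[simp] theorem toReal_add (a b : Fin d → ℤ) : toReal (a + b) = toReal a + toReal b := by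
  ext i; simp [toReal]

@[simp] theorem toReal_zero : toReal (0 : Fin d → ℤ) = 0 := by
  ext i; simp [toReal]

@[simp] theorem toReal_neg (a : Fin d → ℤ) : toReal (-a) = -toReal a := by
  ext i; simp [toReal]

theorem mem_cone_iff (x : Fin d → ℝ) :
    x ∈ cone A ↔ ∃ r : Fin n → ℝ, (∀ j, 0 ≤ r j) ∧ x = ∑ j, r j • toReal (A j) := by
  constructor
  · intro h
    obtain ⟨c, rfl⟩ := Submodule.mem_span_range_iff_exists_fun _ |>.1 h
    exact ⟨fun j => c j, fun j => (c j).2, rfl⟩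
  · rintro ⟨r, hr, rfl⟩
    exact Submodule.sum_mem _ fun j _ =>
      PointedCone.smul_mem _ (hr j) (PointedCone.subset_hull ⟨j, rfl⟩)

theorem toReal_mem_cone (j : Fin n) : toReal (A j) ∈ cone A :=
  PointedCone.subset_hull ⟨j, rfl⟩

theorem span_toReal (hA : AddSubgroup.closure (Set.range A) = ⊤) :
    Submodule.span ℝ (Set.range fun j => toReal (A j)) = ⊤ := by
  have h : ∀ z : Fin d → ℤ, toReal z ∈ Submodule.span ℝ (Set.range fun j => toReal (A j)) := by
    intro z
    have hz : z ∈ AddSubgroup.closure (Set.range A) := by rw [hA]; trivial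
    induction hz using AddSubgroup.closure_induction with
    | mem x hx => obtain ⟨j, rfl⟩ := hx; exact Submodule.subset_span ⟨j, rfl⟩
    | zero => simp
    | add x y _ _ hx hy => rw [toReal_add]; exact Submodule.add_mem _ hx hy
    | neg x _ hx => rw [toReal_neg]; exact Submodule.neg_mem _ hx
  rw [eq_top_iff, ← (Pi.basisFun ℝ (Fin d)).span_eq, Submodule.span_le]
  rintro _ ⟨i, rfl⟩
  have hi : Pi.basisFun ℝ (Fin d) i = toReal (Pi.single i 1) := by
    ext k
    simp [toReal, Pi.single_apply]
  rw [hi]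
  exact h _

variable (A) in
/-- `F` is an extremal form of `ℝ_{≥0}A`: it is nonzero, nonnegative on `A`, and its kernel is
spanned by the elements of `A` on which it vanishes. -/
structure IsExtremal (F : (Fin d → ℝ) →ₗ[ℝ] ℝ) : Prop where
  nonneg : ∀ j, 0 ≤ F (toReal (A j))
  ne_zero : F ≠ 0
  ker_le : LinearMap.ker F ≤
    Submodule.span ℝ ((fun j => toReal (A j)) '' {j | F (toReal (A j)) = 0})

variable (A) in
/-- The face of `ℝ_{≥0}A` on which the linear form `F` vanishes. -/
noncomputable def exposedFace (F : (Fin d → ℝ) →ₗ[ℝ] ℝ) : PointedCone ℝ (Fin d → ℝ) :=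
  cone A ⊓ PointedCone.ofSubmodule (LinearMap.ker F)

theorem mem_exposedFace {F : (Fin d → ℝ) →ₗ[ℝ] ℝ} {x : Fin d → ℝ} :
    x ∈ exposedFace A F ↔ x ∈ cone A ∧ F x = 0 := Iff.rfl

theorem nonneg_of_mem_cone {F : (Fin d → ℝ) →ₗ[ℝ] ℝ} (hF : ∀ j, 0 ≤ F (toReal (A j)))
    {x : Fin d → ℝ} (hx : x ∈ cone A) : 0 ≤ F x := by
  obtain ⟨r, hr, rfl⟩ := (mem_cone_iff x).1 hx
  simp only [map_sum, map_smul, smul_eq_mul]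
  exact Finset.sum_nonneg fun j _ => mul_nonneg (hr j) (hF j)

theorem exposedFace_isFaceOf {F : (Fin d → ℝ) →ₗ[ℝ] ℝ} (hF : ∀ j, 0 ≤ F (toReal (A j))) :
    (exposedFace A F).IsFaceOf (cone A) where
  le := inf_le_left
  mem_of_smul_add_mem := by
    intro x y a hx hy ha h
    refine mem_exposedFace.2 ⟨hx, ?_⟩
    have h0 := (mem_exposedFace.1 h).2
    have h1 := nonneg_of_mem_cone hF hx
    have h2 := nonneg_of_mem_cone hF hy
    simp only [map_add, map_smul, smul_eq_mul] at h0
    have : a * F x = 0 := by nlinarith [mul_nonneg ha.le h1]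
    exact (mul_eq_zero.1 this).resolve_left ha.ne'

theorem exposedFace_ne_cone (hA : AddSubgroup.closure (Set.range A) = ⊤)
    {F : (Fin d → ℝ) →ₗ[ℝ] ℝ} (hF : F ≠ 0) : exposedFace A F ≠ cone A := by
  intro h
  refine hF (LinearMap.ext_on (span_toReal hA) ?_)
  rintro _ ⟨j, rfl⟩
  have : toReal (A j) ∈ exposedFace A F := by rw [h]; exact toReal_mem_cone j
  simpa using (mem_exposedFace.1 this).2

theorem IsExtremal.isFacet (hA : AddSubgroup.closure (Set.range A) = ⊤)
    {F : (Fin d → ℝ) →ₗ[ℝ] ℝ} (hF : IsExtremal A F) : IsFacet A (exposedFace A F) := by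
  classical
  refine ⟨⟨exposedFace_isFaceOf hF.nonneg, exposedFace_ne_cone hA hF.ne_zero⟩, ?_⟩
  rintro τ ⟨hτ, hτne⟩ hle
  by_contra hnot
  obtain ⟨y, hyτ, hy⟩ := SetLike.not_le_iff_exists.1 hnot
  have hyC := hτ.le hyτ
  have hFy : 0 < F y := lt_of_le_of_ne (nonneg_of_mem_cone hF.nonneg hyC)
    fun h => hy (mem_exposedFace.2 ⟨hyC, h.symm⟩)
  refine hτne (le_antisymm hτ.le fun z hz => ?_)
  -- A multiple of `y` minus `z` lies in the kernel of `F`, hence in the span of the face.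
  have hker : (F z / F y) • y - z ∈ LinearMap.ker F := by
    simp [div_mul_cancel₀ _ hFy.ne']
  have hsp := hF.ker_le hker
  have key : ∀ v ∈ Submodule.span ℝ ((fun j => toReal (A j)) '' {j | F (toReal (A j)) = 0}),
      ∃ w ∈ exposedFace A F, v + w ∈ cone A := by
    intro v hv
    induction hv using Submodule.span_induction with
    | mem x hx =>
      obtain ⟨j, -, rfl⟩ := hx
      exact ⟨0, zero_mem _, by simpa using toReal_mem_cone j⟩
    | zero => exact ⟨0, zero_mem _, by simp⟩
    | add x y _ _ hx hy =>
      obtain ⟨u, hu, hxu⟩ := hx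
      obtain ⟨w, hw, hyw⟩ := hy
      exact ⟨u + w, add_mem hu hw, by
        rw [add_add_add_comm]; exact add_mem hxu hyw⟩
    | smul a x hxs hx =>
      obtain ⟨u, hu, hxu⟩ := hx
      have hFx : F x = 0 := by
        have : Submodule.span ℝ ((fun j => toReal (A j)) '' {j | F (toReal (A j)) = 0})
            ≤ LinearMap.ker F := by
          rw [Submodule.span_le]
          rintro _ ⟨j, hj, rfl⟩
          exact hj
        exact this hxs
      have hFu := (mem_exposedFace.1 hu).2
      rcases le_total 0 a with ha | ha
      · exact ⟨a • u, PointedCone.smul_mem _ ha hu, by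
          rw [← smul_add]; exact PointedCone.smul_mem _ ha hxu⟩
      · refine ⟨(-a) • (x + u), PointedCone.smul_mem _ (by linarith)
          (mem_exposedFace.2 ⟨hxu, by simp [hFx, hFu]⟩), ?_⟩
        have : a • x + (-a) • (x + u) = (-a) • u := by rw [smul_add, neg_smul a x]; abel
        rw [this]
        exact PointedCone.smul_mem _ (by linarith) (mem_exposedFace.1 hu).1
  obtain ⟨w, hw, hvw⟩ := key _ hsp
  refine hτ.mem_of_add_mem_left hz hvw ?_
  have : z + ((F z / F y) • y - z + w) = (F z / F y) • y + w := by abel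
  rw [this]
  exact add_mem (PointedCone.smul_mem _ (div_nonneg (nonneg_of_mem_cone hF.nonneg hz) hFy.le) hyτ)
    (hle hw)

theorem mem_face_iff {σ : PointedCone ℝ (Fin d → ℝ)} (hσ : σ.IsFaceOf (cone A))
    (x : Fin d → ℝ) : x ∈ σ ↔ ∃ r : Fin n → ℝ, (∀ j, 0 ≤ r j) ∧
      (∀ j, 0 < r j → toReal (A j) ∈ σ) ∧ x = ∑ j, r j • toReal (A j) := by
  constructor
  · intro hx
    obtain ⟨r, hr, rfl⟩ := (mem_cone_iff x).1 (hσ.le hx)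
    exact ⟨r, hr, fun j hj => hσ.mem_of_sum_smul_mem toReal_mem_cone hr hx j hj, rfl⟩
  · rintro ⟨r, hr, hrσ, rfl⟩
    refine Submodule.sum_mem _ fun j _ => ?_
    rcases (hr j).eq_or_lt with h | h
    · rw [← h, zero_smul]; exact zero_mem _
    · exact PointedCone.smul_mem _ h.le (hrσ j h)

/-- Every facet is the zero set of an extremal form. Farkas' lemma is applied to `A` together with
the negative of a relative interior point of the facet. -/
theorem IsFacet.exists_extremal (hA : AddSubgroup.closure (Set.range A) = ⊤)
    {σ : PointedCone ℝ (Fin d → ℝ)} (hσ : IsFacet A σ) :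
    ∃ F, IsExtremal A F ∧ σ = exposedFace A F := by
  classical
  have hface := hσ.1.1
  set s : Fin d → ℝ := ∑ j ∈ Finset.univ.filter (fun j => toReal (A j) ∈ σ), toReal (A j) with hs
  have hsσ : s ∈ σ := Submodule.sum_mem _ fun j hj => by simpa using hj
  set e : Fin d → ℝ := ∑ j, toReal (A j) with he
  have heC : e ∈ cone A := Submodule.sum_mem _ fun j _ => toReal_mem_cone j
  rcases farkas (Finset.univ : Finset (Option (Fin n)))
    (fun o => o.elim (-s) fun j => toReal (A j)) (-e) with ⟨r, hr, h⟩ | ⟨F, hF, hFe⟩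
  · exfalso
    rw [Fintype.sum_option] at h
    simp only [Option.elim_none, Option.elim_some] at h
    have h1 : e + ∑ j, r (some j) • toReal (A j) = r none • s := by
      have : e = r none • s - ∑ j, r (some j) • toReal (A j) := by
        rw [← neg_neg e, h, smul_neg]; abel
      rw [this]; abel
    have h2 : e ∈ σ := by
      refine hface.mem_of_add_mem_left heC
        ((mem_cone_iff _).2 ⟨fun j => r (some j), fun j => hr _, rfl⟩) ?_
      rw [h1]
      exact PointedCone.smul_mem _ (hr _) hsσ
    have h3 : ∀ j, toReal (A j) ∈ σ := hface.mem_of_sum_mem toReal_mem_cone h2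
    refine hσ.1.2 (le_antisymm hface.le fun x hx => ?_)
    obtain ⟨r, hr, rfl⟩ := (mem_cone_iff x).1 hx
    exact Submodule.sum_mem _ fun j _ => PointedCone.smul_mem _ (hr j) (h3 j)
  · have hFA : ∀ j, 0 ≤ F (toReal (A j)) := fun j => hF (some j) (Finset.mem_univ _)
    have hFs : F s ≤ 0 := by simpa using hF none (Finset.mem_univ _)
    have hFσ : ∀ j, toReal (A j) ∈ σ → F (toReal (A j)) = 0 := by
      intro j hj
      rw [hs, map_sum] at hFs
      have hmem : j ∈ Finset.univ.filter (fun j => toReal (A j) ∈ σ) := by simpa using hj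
      have := Finset.single_le_sum (f := fun j => F (toReal (A j))) (fun j _ => hFA j) hmem
      exact le_antisymm (this.trans hFs) (hFA j)
    obtain ⟨F', h1, h2, h3, h4⟩ := exists_extremal_form (fun j => toReal (A j)) (span_toReal hA)
      (-e) F hFA hFe
    have hne : F' ≠ 0 := by rintro rfl; simp at h2
    refine ⟨F', ⟨h1, hne, h4⟩, ?_⟩
    have hle : σ ≤ exposedFace A F' := fun x hx => by
      refine mem_exposedFace.2 ⟨hface.le hx, ?_⟩
      obtain ⟨r, hr, hrσ, rfl⟩ := (mem_face_iff hface x).1 hx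
      rw [map_sum]
      refine Finset.sum_eq_zero fun j _ => ?_
      rcases (hr j).eq_or_lt with h | h
      · simp [← h]
      · simp [h3 j (hFσ j (hrσ j h))]
    exact le_antisymm hle (hσ.2 ⟨exposedFace_isFaceOf h1, exposedFace_ne_cone hA hne⟩ hle)

instance finite_facet : Finite (Facet A) := by
  refine Finite.of_injective (fun σ : Facet A => {j : Fin n | toReal (A j) ∈ σ.1}) ?_
  intro σ τ h
  have h' : ∀ j, toReal (A j) ∈ σ.1 ↔ toReal (A j) ∈ τ.1 := fun j => Set.ext_iff.1 h j
  ext x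
  rw [mem_face_iff σ.2.1.1, mem_face_iff τ.2.1.1]
  simp only [h']

/-- A linear form vanishing where the extremal form `F` does is a multiple of `F`. -/
theorem IsExtremal.exists_eq_smul {F G : (Fin d → ℝ) →ₗ[ℝ] ℝ} (hF : IsExtremal A F)
    (hG : ∀ j, F (toReal (A j)) = 0 → G (toReal (A j)) = 0) : ∃ c : ℝ, G = c • F := by
  obtain ⟨x₀, hx₀⟩ : ∃ x, F x ≠ 0 := by
    by_contra! h
    exact hF.ne_zero (LinearMap.ext h)
  have hle : LinearMap.ker F ≤ LinearMap.ker G := by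
    refine hF.ker_le.trans (Submodule.span_le.2 ?_)
    rintro _ ⟨j, hj, rfl⟩
    exact hG j hj
  refine ⟨G x₀ / F x₀, LinearMap.ext fun v => ?_⟩
  have : v - (F v / F x₀) • x₀ ∈ LinearMap.ker F := by simp [div_mul_cancel₀ _ hx₀]
  have h0 : G (v - (F v / F x₀) • x₀) = 0 := hle this
  simp only [map_sub, map_smul, smul_eq_mul, sub_eq_zero] at h0
  rw [h0, LinearMap.smul_apply, smul_eq_mul]
  ring

theorem IsExtremal.exists_int_form {F : (Fin d → ℝ) →ₗ[ℝ] ℝ} (hF : IsExtremal A F) :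
    ∃ g : Fin d → ℤ, g ≠ 0 ∧ ∀ j, F (toReal (A j)) = 0 → ∑ i, g i * A j i = 0 := by
  classical
  let W : Submodule ℚ (Fin d → ℚ) :=
    Submodule.span ℚ ((fun j i => (A j i : ℚ)) '' {j | F (toReal (A j)) = 0})
  have hW : ∀ v ∈ W, F (fun i => (v i : ℝ)) = 0 := by
    intro v hv
    induction hv using Submodule.span_induction with
    | mem x hx =>
      obtain ⟨j, hj, rfl⟩ := hx
      simp only [Rat.cast_intCast]
      exact hj
    | zero =>
      have : (fun i => ((0 : Fin d → ℚ) i : ℝ)) = 0 := by ext; simp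
      rw [this, map_zero]
    | add x y _ _ hx hy =>
      have : (fun i => ((x + y) i : ℝ)) = (fun i => (x i : ℝ)) + fun i => (y i : ℝ) := by
        ext; simp
      rw [this, map_add, hx, hy, add_zero]
    | smul a x _ hx =>
      have : (fun i => ((a • x) i : ℝ)) = (a : ℝ) • fun i => (x i : ℝ) := by ext; simp
      rw [this, map_smul, hx, smul_zero]
  obtain ⟨i₀, hi₀⟩ : ∃ i, (Pi.single i 1 : Fin d → ℚ) ∉ W := by
    by_contra! h
    refine hF.ne_zero ((Pi.basisFun ℝ (Fin d)).ext fun i => ?_)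
    rw [LinearMap.zero_apply, ← hW _ (h i)]
    congr 1
    ext k
    simp only [Pi.basisFun_apply, Pi.single_apply]
    split_ifs <;> simp
  obtain ⟨G, hG, hGW⟩ := Submodule.exists_le_ker_of_notMem hi₀
  let D : ℤ := ∏ i, ((G (Pi.single i 1)).den : ℤ)
  have hD : D ≠ 0 := Finset.prod_ne_zero_iff.2 fun i _ => by
    exact_mod_cast (G (Pi.single i 1)).den_nz
  have hint : ∀ i, ∃ z : ℤ, (z : ℚ) = D * G (Pi.single i 1) := by
    intro i
    refine ⟨(∏ k ∈ Finset.univ.erase i, ((G (Pi.single k 1)).den : ℤ)) *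
      (G (Pi.single i 1)).num, ?_⟩
    have : D = (∏ k ∈ Finset.univ.erase i, ((G (Pi.single k 1)).den : ℤ)) *
        ((G (Pi.single i 1)).den : ℤ) := (Finset.prod_erase_mul _ _ (Finset.mem_univ i)).symm
    rw [this]
    push_cast
    rw [mul_assoc, Rat.den_mul_eq_num]
  choose g hg using hint
  refine ⟨g, fun h => ?_, fun j hj => ?_⟩
  · have := hg i₀
    rw [h] at this
    simp only [Pi.zero_apply, Int.cast_zero, zero_eq_mul, Int.cast_eq_zero] at this
    exact this.elim hD hG
  · have h1 : G (fun i => (A j i : ℚ)) = 0 := hGW (Submodule.subset_span ⟨j, hj, rfl⟩)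
    have h2 : (fun i => (A j i : ℚ)) = ∑ i, (A j i : ℚ) • (Pi.single i 1 : Fin d → ℚ) := by
      ext k
      simp [Finset.sum_apply, Pi.single_apply]
    rw [h2, map_sum] at h1
    have h3 : ((∑ i, g i * A j i : ℤ) : ℚ) = D * ∑ i, G ((A j i : ℚ) • Pi.single i 1) := by
      push_cast
      rw [Finset.mul_sum]
      refine Finset.sum_congr rfl fun i _ => ?_
      rw [hg i, map_smul, smul_eq_mul]; ring
    rw [h1, mul_zero] at h3
    exact_mod_cast h3

theorem IsExtremal.exists_primitive {F : (Fin d → ℝ) →ₗ[ℝ] ℝ} (hF : IsExtremal A F) :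
    ∃ P, IsPrimitiveSupport A (exposedFace A F) P := by
  classical
  obtain ⟨g, hg0, hg⟩ := hF.exists_int_form
  let φ : (Fin d → ℤ) →+ ℤ :=
    { toFun := fun x => ∑ i, g i * x i
      map_zero' := by simp
      map_add' := fun x y => by simp [mul_add, Finset.sum_add_distrib] }
  obtain ⟨m, hm⟩ := Int.subgroup_cyclic φ.range
  have hm' : ∀ z : ℤ, z ∈ φ.range ↔ ∃ k : ℤ, k * m = z := by
    intro z
    rw [hm, ← AddSubgroup.zmultiples_eq_closure, AddSubgroup.mem_zmultiples_iff]
    simp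
  have hm0 : m ≠ 0 := by
    rintro rfl
    refine hg0 (funext fun i => ?_)
    obtain ⟨k, hk⟩ := (hm' (g i)).1 ⟨Pi.single i 1, by simp [φ, Pi.single_apply]⟩
    simpa using hk.symm
  let Φ : (Fin d → ℝ) →ₗ[ℝ] ℝ := ∑ i, ((g i : ℝ) / m) • LinearMap.proj i
  have hΦ : ∀ x : Fin d → ℤ, Φ (toReal x) = (φ x : ℝ) / m := by
    intro x
    simp only [Φ, LinearMap.sum_apply, LinearMap.smul_apply, LinearMap.proj_apply, smul_eq_mul,
      toReal, φ, AddMonoidHom.coe_mk, ZeroHom.coe_mk]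
    push_cast
    rw [Finset.sum_div]
    exact Finset.sum_congr rfl fun i _ => by ring
  have hm0' : (m : ℝ) ≠ 0 := by exact_mod_cast hm0
  have hrange : ∀ ε : ℤ, ε = 1 ∨ ε = -1 →
      Set.range (fun a : Fin d → ℤ => ((ε : ℝ) • Φ) (toReal a)) = Set.range ((↑) : ℤ → ℝ) := by
    intro ε hε
    have hεε : ε * ε = 1 := by rcases hε with rfl | rfl <;> rfl
    ext y
    constructor
    · rintro ⟨a, rfl⟩
      obtain ⟨k, hk⟩ := (hm' (φ a)).1 ⟨a, rfl⟩
      refine ⟨ε * k, ?_⟩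
      simp only [LinearMap.smul_apply, hΦ, smul_eq_mul, ← hk]
      push_cast
      field_simp
    · rintro ⟨k, rfl⟩
      obtain ⟨a, ha⟩ := (hm' (ε * k * m)).2 ⟨ε * k, rfl⟩
      refine ⟨a, ?_⟩
      simp only [LinearMap.smul_apply, hΦ, smul_eq_mul, ha]
      push_cast
      have : (ε : ℝ) * ε = 1 := by exact_mod_cast hεε
      field_simp
      linear_combination (k : ℝ) * this
  obtain ⟨c, hc⟩ := hF.exists_eq_smul (G := Φ) fun j hj => by
    rw [hΦ]; simp [φ, hg j hj]
  have main : ∀ ε : ℤ, ε = 1 ∨ ε = -1 → 0 ≤ (ε : ℝ) * c →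
      ∃ P, IsPrimitiveSupport A (exposedFace A F) P := by
    intro ε hε hεc
    refine ⟨(ε : ℝ) • Φ, fun x hx => ?_, fun x hx => ?_, hrange ε hε⟩
    · rw [hc, smul_smul]
      exact mul_nonneg hεc (nonneg_of_mem_cone hF.nonneg hx)
    · rw [hc, smul_smul, LinearMap.smul_apply, (mem_exposedFace.1 hx).2, smul_zero]
  rcases le_total 0 c with h | h
  · exact main 1 (Or.inl rfl) (by simpa using h)
  · exact main (-1) (Or.inr rfl) (by simpa using h)

theorem supp_spec (hA : AddSubgroup.closure (Set.range A) = ⊤) (σ : Facet A) :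
    IsPrimitiveSupport A σ.1 (supp A σ) := by
  obtain ⟨F, hF, hσ⟩ := σ.2.exists_extremal hA
  obtain ⟨P, hP⟩ := hF.exists_primitive
  exact Classical.epsilon_spec (p := IsPrimitiveSupport A σ.1) ⟨P, hσ ▸ hP⟩

theorem supp_eq_smul (hA : AddSubgroup.closure (Set.range A) = ⊤) (σ : Facet A)
    {F : (Fin d → ℝ) →ₗ[ℝ] ℝ} (hF : IsExtremal A F) (hσ : σ.1 = exposedFace A F) :
    ∃ c : ℝ, 0 < c ∧ supp A σ = c • F := by
  have hP := supp_spec hA σ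
  obtain ⟨c, hc⟩ := hF.exists_eq_smul (G := supp A σ) fun j hj =>
    hP.eq_zero _ (by rw [hσ]; exact mem_exposedFace.2 ⟨toReal_mem_cone j, hj⟩)
  refine ⟨c, ?_, hc⟩
  obtain ⟨j, hj⟩ : ∃ j, F (toReal (A j)) ≠ 0 := by
    by_contra! h
    exact hF.ne_zero (LinearMap.ext_on (span_toReal hA) (by rintro _ ⟨j, rfl⟩; simpa using h j))
  have hFj := lt_of_le_of_ne (hF.nonneg j) hj.symm
  have h1 := hP.nonneg _ (toReal_mem_cone j)
  rw [hc] at h1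
  have hc0 : c ≠ 0 := by
    rintro rfl
    have : (1 : ℝ) ∈ Set.range ((↑) : ℤ → ℝ) := ⟨1, by simp⟩
    rw [← hP.image_lattice, hc] at this
    simp at this
  simp only [LinearMap.smul_apply, smul_eq_mul] at h1
  exact lt_of_le_of_ne (nonneg_of_mul_nonneg_left h1 hFj) hc0.symm

/-- The kernel of the support function of a facet is spanned by the elements of `A` in it. -/
theorem mem_span_of_supp_eq_zero (hA : AddSubgroup.closure (Set.range A) = ⊤) (σ : Facet A)
    {x : Fin d → ℝ} (hx : supp A σ x = 0) :
    x ∈ Submodule.span ℝ ((fun j => toReal (A j)) '' {j | supp A σ (toReal (A j)) = 0}) := by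
  obtain ⟨F, hF, hσ⟩ := σ.2.exists_extremal hA
  obtain ⟨c, hc, h⟩ := supp_eq_smul hA σ hF hσ
  have hz : ∀ y, supp A σ y = 0 ↔ F y = 0 := fun y => by simp [h, hc.ne']
  simp only [hz] at hx ⊢
  exact hF.ker_le hx

/-- The cone is cut out by the support functions of its facets. -/
theorem mem_cone_of_supp_nonneg (hA : AddSubgroup.closure (Set.range A) = ⊤)
    {x : Fin d → ℝ} (hx : ∀ σ : Facet A, 0 ≤ supp A σ x) : x ∈ cone A := by
  rcases farkas Finset.univ (fun j => toReal (A j)) x with ⟨r, hr, h⟩ | ⟨F, hF, hFx⟩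
  · exact (mem_cone_iff x).2 ⟨r, hr, h⟩
  · exfalso
    obtain ⟨F', h1, h2, -, h4⟩ := exists_extremal_form _ (span_toReal hA) x F
      (fun j => hF j (Finset.mem_univ j)) hFx
    have hE : IsExtremal A F' := ⟨h1, by rintro rfl; simp at h2, h4⟩
    obtain ⟨c, hc, h⟩ := supp_eq_smul hA ⟨_, hE.isFacet hA⟩ hE rfl
    have := hx ⟨_, hE.isFacet hA⟩
    rw [h, LinearMap.smul_apply, smul_eq_mul] at this
    nlinarith

end Facets

/-! ### Values of the support functions on the semigroup -/

section Values

variable {d n : ℕ} {A : Fin n → Fin d → ℤ}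

/-- The integer coefficients of the support function of a facet. -/
noncomputable def suppVec (σ : Facet A) (i : Fin d) : ℤ := ⌊supp A σ (Pi.single i 1)⌋

/-- The support function of a facet on `ℤ^d`, with values in `ℤ`. -/
noncomputable def suppZ (σ : Facet A) : (Fin d → ℤ) →+ ℤ where
  toFun x := ∑ i, suppVec σ i * x i
  map_zero' := by simp
  map_add' x y := by simp [mul_add, Finset.sum_add_distrib]

theorem suppZ_apply (σ : Facet A) (x : Fin d → ℤ) : suppZ σ x = ∑ i, suppVec σ i * x i := rfl

theorem suppVec_cast (hA : AddSubgroup.closure (Set.range A) = ⊤) (σ : Facet A) (i : Fin d) :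
    supp A σ (Pi.single i 1) = (suppVec σ i : ℝ) := by
  have h : supp A σ (toReal (Pi.single i 1)) ∈ Set.range ((↑) : ℤ → ℝ) := by
    rw [← (supp_spec hA σ).image_lattice]
    exact ⟨Pi.single i 1, rfl⟩
  have hi : toReal (Pi.single i 1) = (Pi.single i 1 : Fin d → ℝ) := by
    ext k
    simp [toReal, Pi.single_apply]
  rw [hi] at h
  obtain ⟨z, hz⟩ := h
  rw [suppVec, ← hz, Int.floor_intCast]

theorem supp_apply (hA : AddSubgroup.closure (Set.range A) = ⊤) (σ : Facet A) (x : Fin d → ℝ) :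
    supp A σ x = ∑ i, (suppVec σ i : ℝ) * x i := by
  conv_lhs => rw [pi_eq_sum_univ' x]
  rw [map_sum]
  refine Finset.sum_congr rfl fun i _ => ?_
  rw [map_smul, smul_eq_mul, mul_comm, ← suppVec_cast hA]

theorem supp_toReal (hA : AddSubgroup.closure (Set.range A) = ⊤) (σ : Facet A)
    (x : Fin d → ℤ) : supp A σ (toReal x) = (suppZ σ x : ℝ) := by
  rw [supp_apply hA, suppZ_apply]
  push_cast
  rfl

theorem suppC_apply (hA : AddSubgroup.closure (Set.range A) = ⊤) (σ : Facet A)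
    (α : Fin d → ℂ) : suppC A σ α = ∑ i, (suppVec σ i : ℂ) * α i := by
  refine Finset.sum_congr rfl fun i _ => ?_
  rw [suppVec_cast hA, mul_comm]
  simp

/-- The inclusion `ℤ^d → ℂ^d`. -/
def toC (a : Fin d → ℤ) : Fin d → ℂ := fun i => (a i : ℂ)

@[simp] theorem toC_add (a b : Fin d → ℤ) : toC (a + b) = toC a + toC b := by
  ext i; simp [toC]

@[simp] theorem toC_zero : toC (0 : Fin d → ℤ) = 0 := by
  ext i; simp [toC]

@[simp] theorem toC_neg (a : Fin d → ℤ) : toC (-a) = -toC a := by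
  ext i; simp [toC]

theorem suppC_add (σ : Facet A) (α β : Fin d → ℂ) :
    suppC A σ (α + β) = suppC A σ α + suppC A σ β := by
  simp [suppC, add_mul, Finset.sum_add_distrib]

theorem suppC_toC (hA : AddSubgroup.closure (Set.range A) = ⊤) (σ : Facet A)
    (a : Fin d → ℤ) : suppC A σ (toC a) = (suppZ σ a : ℂ) := by
  rw [suppC_apply hA, suppZ_apply]
  push_cast
  rfl

theorem mem_NA (j : Fin n) : A j ∈ NA A := AddSubmonoid.subset_closure (Set.mem_range_self j)

theorem toReal_mem_cone_of_mem_NA {x : Fin d → ℤ} (hx : x ∈ NA A) : toReal x ∈ cone A := by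
  induction hx using AddSubmonoid.closure_induction with
  | mem x hx => obtain ⟨j, rfl⟩ := hx; exact toReal_mem_cone j
  | zero => simp
  | add x y _ _ hx hy => rw [toReal_add]; exact add_mem hx hy

theorem suppZ_nonneg (hA : AddSubgroup.closure (Set.range A) = ⊤) (σ : Facet A)
    {x : Fin d → ℤ} (hx : x ∈ NA A) : 0 ≤ suppZ σ x := by
  have := (supp_spec hA σ).nonneg _ (toReal_mem_cone_of_mem_NA hx)
  rw [supp_toReal hA] at this
  exact_mod_cast this

theorem exists_suppZ_eq_one (hA : AddSubgroup.closure (Set.range A) = ⊤) (σ : Facet A) :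
    ∃ x, suppZ σ x = 1 := by
  have : (1 : ℝ) ∈ Set.range ((↑) : ℤ → ℝ) := ⟨1, by simp⟩
  rw [← (supp_spec hA σ).image_lattice] at this
  obtain ⟨x, hx⟩ := this
  refine ⟨x, ?_⟩
  simp only [supp_toReal hA] at hx
  exact_mod_cast hx

/-- `ℤ^d` is the group of differences of `ℕA`. -/
theorem exists_mem_NA_add_mem (hA : AddSubgroup.closure (Set.range A) = ⊤) (x : Fin d → ℤ) :
    ∃ u ∈ NA A, u + x ∈ NA A := by
  have hx : x ∈ AddSubgroup.closure (Set.range A) := by rw [hA]; trivial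
  induction hx using AddSubgroup.closure_induction with
  | mem x hx => obtain ⟨j, rfl⟩ := hx; exact ⟨0, zero_mem _, by simpa using mem_NA j⟩
  | zero => exact ⟨0, zero_mem _, by simp⟩
  | add x y _ _ hx hy =>
    obtain ⟨u, hu, hux⟩ := hx
    obtain ⟨v, hv, hvy⟩ := hy
    exact ⟨u + v, add_mem hu hv, by rw [add_add_add_comm]; exact add_mem hux hvy⟩
  | neg x _ hx =>
    obtain ⟨u, hu, hux⟩ := hx
    exact ⟨u + x, hux, by simpa using hu⟩

/-- The lattice points of the cone are contained in a translate of the semigroup. -/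
theorem exists_conductor (hA : AddSubgroup.closure (Set.range A) = ⊤) :
    ∃ c ∈ NA A, ∀ x : Fin d → ℤ, toReal x ∈ cone A → c + x ∈ NA A := by
  classical
  let B : Set (Fin d → ℤ) := {x | ∃ r : Fin n → ℝ, (∀ j, 0 ≤ r j ∧ r j ≤ 1) ∧
    toReal x = ∑ j, r j • toReal (A j)}
  have hB : B.Finite := by
    let M : Fin d → ℤ := fun i => ∑ j, |A j i|
    refine (Set.finite_Icc (-M) M).subset ?_
    rintro x ⟨r, hr, hx⟩
    have habs : ∀ i, |x i| ≤ M i := by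
      intro i
      have h1 : (x i : ℝ) = ∑ j, r j * (A j i : ℝ) := by
        have := congrFun hx i
        simpa [toReal, Finset.sum_apply] using this
      have h2 : |(x i : ℝ)| ≤ ∑ j, |(A j i : ℝ)| := by
        rw [h1]
        refine (Finset.abs_sum_le_sum_abs _ _).trans (Finset.sum_le_sum fun j _ => ?_)
        rw [abs_mul, abs_of_nonneg (hr j).1]
        exact mul_le_of_le_one_left (abs_nonneg _) (hr j).2
      have h3 : ((|x i| : ℤ) : ℝ) ≤ ((M i : ℤ) : ℝ) := by
        simp only [M]
        push_cast
        exact h2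
      exact_mod_cast h3
    exact ⟨fun i => (abs_le.1 (habs i)).1, fun i => (abs_le.1 (habs i)).2⟩
  choose u hu hux using exists_mem_NA_add_mem hA
  refine ⟨∑ x ∈ hB.toFinset, u x, sum_mem fun x _ => hu x, fun x hx => ?_⟩
  obtain ⟨r, hr, hxr⟩ := (mem_cone_iff _).1 hx
  -- Subtracting the integral parts of the coefficients leaves a point of the finite set `B`.
  set q : Fin d → ℤ := ∑ j, ⌊r j⌋₊ • A j with hq
  have hqS : q ∈ NA A := sum_mem fun j _ => nsmul_mem (mem_NA j) _
  have hy : x - q ∈ B := by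
    refine ⟨fun j => r j - ⌊r j⌋₊, fun j => ⟨sub_nonneg.2 (Nat.floor_le (hr j)), ?_⟩, ?_⟩
    · have := Nat.lt_floor_add_one (r j)
      linarith
    · ext i
      have := congrFun hxr i
      simp only [toReal, Finset.sum_apply, Pi.smul_apply, smul_eq_mul] at this
      simp only [toReal, hq, Pi.sub_apply, Finset.sum_apply, Pi.smul_apply, smul_eq_mul,
        nsmul_eq_mul, sub_mul, Finset.sum_sub_distrib]
      push_cast
      rw [this]
      simp
  rw [← Finset.add_sum_erase _ _ (hB.mem_toFinset.2 hy)]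
  have : u (x - q) + ∑ y ∈ hB.toFinset.erase (x - q), u y + x
      = (u (x - q) + (x - q)) + (∑ y ∈ hB.toFinset.erase (x - q), u y + q) := by abel
  rw [this]
  exact add_mem (hux _) (add_mem (sum_mem fun y _ => hu y) hqS)

/-- The numerical semigroup `F_σ(ℕA)` contains all large integers: it contains two consecutive
integers `k` and `k + 1`, hence everything from `k²` on. -/
theorem exists_forall_ge_mem_image (hA : AddSubgroup.closure (Set.range A) = ⊤) (σ : Facet A) :
    ∃ N : ℤ, ∀ m ≥ N, ∃ s ∈ NA A, suppZ σ s = m := by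
  obtain ⟨z, hz⟩ := exists_suppZ_eq_one hA σ
  obtain ⟨u, hu, huz⟩ := exists_mem_NA_add_mem hA z
  set k := suppZ σ u with hk
  have hk0 : 0 ≤ k := suppZ_nonneg hA σ hu
  have hk1 : suppZ σ (u + z) = k + 1 := by rw [map_add, hz]
  refine ⟨k * k, fun m hm => ?_⟩
  rcases hk0.eq_or_lt with h0 | hpos
  · have hm0 : 0 ≤ m := by rw [← h0] at hm; simpa using hm
    refine ⟨m.toNat • (u + z), nsmul_mem huz _, ?_⟩
    rw [map_nsmul, hk1, ← h0, nsmul_eq_mul]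
    simp [hm0]
  · have hr0 := Int.emod_nonneg m hpos.ne'
    have hr1 := Int.emod_lt_of_pos m hpos
    have hdiv := Int.mul_ediv_add_emod m k
    have hq : k ≤ m / k := (Int.le_ediv_iff_mul_le hpos).2 hm
    refine ⟨(m / k - m % k).toNat • u + (m % k).toNat • (u + z),
      add_mem (nsmul_mem hu _) (nsmul_mem huz _), ?_⟩
    rw [map_add, map_nsmul, map_nsmul, hk1, ← hk, nsmul_eq_mul, nsmul_eq_mul,
      Int.toNat_of_nonneg (by linarith), Int.toNat_of_nonneg hr0]
    linear_combination hdiv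

theorem mem_valuesNA (hA : AddSubgroup.closure (Set.range A) = ⊤) (σ : Facet A) (z : ℤ) :
    (z : ℝ) ∈ valuesNA A σ ↔ ∃ s ∈ NA A, suppZ σ s = z := by
  simp only [valuesNA, Set.mem_image, SetLike.mem_coe, supp_toReal hA, Int.cast_inj]

theorem mem_facetsPos (hA : AddSubgroup.closure (Set.range A) = ⊤) (σ : Facet A)
    (α : Fin d → ℂ) :
    σ ∈ facetsPos A α ↔ ∃ s ∈ NA A, suppC A σ α = (suppZ σ s : ℂ) := by
  constructor
  · rintro ⟨_, ⟨s, hs, rfl⟩, h⟩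
    refine ⟨s, hs, ?_⟩
    rw [← h]
    simp only [supp_toReal hA, Complex.ofReal_intCast]
  · rintro ⟨s, hs, h⟩
    refine ⟨_, ⟨s, hs, rfl⟩, ?_⟩
    rw [h]
    simp only [supp_toReal hA, Complex.ofReal_intCast]

theorem mem_facetsNeg (σ : Facet A) (α : Fin d → ℂ) :
    σ ∈ facetsNeg A α ↔ (∃ z : ℤ, suppC A σ α = z) ∧ σ ∉ facetsPos A α := by
  simp only [facetsNeg, facetsPos, Set.mem_sdiff, Set.mem_range, Set.mem_ofPred_eq, eq_comm]

theorem isScored_iff (hA : AddSubgroup.closure (Set.range A) = ⊤) :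
    IsScored A ↔ ∀ x : Fin d → ℤ, (∀ σ : Facet A, σ ∈ facetsPos A (toC x)) → x ∈ NA A := by
  have key : ∀ (σ : Facet A) (x : Fin d → ℤ),
      supp A σ (toReal x) ∈ valuesNA A σ ↔ σ ∈ facetsPos A (toC x) := by
    intro σ x
    rw [supp_toReal hA, mem_valuesNA hA, mem_facetsPos hA, suppC_toC hA]
    simp only [Int.cast_inj, eq_comm]
  rw [IsScored, Set.ext_iff]
  simp only [Set.mem_iInter, Set.mem_ofPred_eq, SetLike.mem_coe]
  refine ⟨fun h x hx => (h x).2 fun σ => (key σ x).2 (hx σ), fun h x => ⟨fun hx σ => ⟨x, hx, rfl⟩,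
    fun hx => h x fun σ => (key σ x).1 (hx σ)⟩⟩

end Values

/-! ### Polynomial functions on a commutative monoid -/

section PolynomialFunctions

variable {M : Type*} [AddCommMonoid M]

/-- `IsPolyFun m φ` says that `φ : M → ℂ` is a polynomial function of degree at most `m`, in the
sense that all its `(m + 1)`-fold differences vanish. -/
def IsPolyFun : ℕ → (M → ℂ) → Prop
  | 0, φ => ∀ c b, φ (b + c) = φ b
  | m + 1, φ => ∀ c, IsPolyFun m fun b => φ (b + c) - φ b

theorem isPolyFun_const (m : ℕ) (z : ℂ) : IsPolyFun m fun _ : M => z := by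
  induction m generalizing z with
  | zero => intro c b; rfl
  | succ m ih => intro c; simpa using ih 0

theorem IsPolyFun.add {m : ℕ} {φ ψ : M → ℂ} (hφ : IsPolyFun m φ) (hψ : IsPolyFun m ψ) :
    IsPolyFun m fun b => φ b + ψ b := by
  induction m generalizing φ ψ with
  | zero => intro c b; simp only [hφ c b, hψ c b]
  | succ m ih =>
    intro c
    convert ih (hφ c) (hψ c) using 2 with b
    ring

theorem IsPolyFun.succ {m : ℕ} {φ : M → ℂ} (hφ : IsPolyFun m φ) : IsPolyFun (m + 1) φ := by
  induction m generalizing φ with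
  | zero => intro c; convert isPolyFun_const 0 0 using 2 with b; rw [hφ c b, sub_self]
  | succ m ih => intro c; exact ih (hφ c)

theorem IsPolyFun.mono {m k : ℕ} (h : m ≤ k) {φ : M → ℂ} (hφ : IsPolyFun m φ) :
    IsPolyFun k φ := by
  induction h with
  | refl => exact hφ
  | step _ ih => exact ih.succ

theorem IsPolyFun.shift {m : ℕ} {φ : M → ℂ} (hφ : IsPolyFun m φ) (a : M) :
    IsPolyFun m fun b => φ (b + a) := by
  induction m generalizing φ with
  | zero => intro c b; simp only [add_right_comm b c a, hφ c (b + a)]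
  | succ m ih => intro c; simpa only [add_right_comm _ c a] using ih (hφ c)

theorem IsPolyFun.mul {m k : ℕ} {φ ψ : M → ℂ} (hφ : IsPolyFun m φ) (hψ : IsPolyFun k ψ) :
    IsPolyFun (m + k) fun b => φ b * ψ b := by
  obtain ⟨s, hs⟩ : ∃ s, s = m + k := ⟨_, rfl⟩
  induction s generalizing m k φ ψ with
  | zero =>
    obtain ⟨rfl, rfl⟩ : m = 0 ∧ k = 0 := by omega
    intro c b
    simp only [hφ c b, hψ c b]
  | succ s ih =>
    rw [← hs]
    intro c
    have heq : (fun b => φ (b + c) * ψ (b + c) - φ b * ψ b) =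
        fun b => (φ (b + c) - φ b) * ψ (b + c) + φ b * (ψ (b + c) - ψ b) := by
      funext b; ring
    rw [heq]
    refine IsPolyFun.add ?_ ?_
    · cases m with
      | zero => simpa only [hφ c _, sub_self, zero_mul] using isPolyFun_const s 0
      | succ m =>
        have hmk : s = m + k := by omega
        rw [hmk]
        exact ih (hφ c) (hψ.shift c) hmk
    · cases k with
      | zero => simpa only [hψ c _, sub_self, mul_zero] using isPolyFun_const s 0
      | succ k =>
        have hmk : s = m + k := by omega
        rw [hmk]
        exact ih hφ (hψ c) hmk

theorem IsPolyFun.fwdDiff_iter {m : ℕ} {φ : M → ℂ} (hφ : IsPolyFun m φ) (h : M) (i : ℕ) :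
    IsPolyFun m ((fwdDiff h)^[i] φ) := by
  induction i with
  | zero => exact hφ
  | succ i ih => rw [Function.iterate_succ_apply']; exact ih.succ h

theorem IsPolyFun.fwdDiff_iter_eq_zero {m : ℕ} {φ : M → ℂ} (hφ : IsPolyFun m φ) (h : M) {i : ℕ}
    (hi : m < i) : (fwdDiff h)^[i] φ = 0 := by
  induction m generalizing φ i with
  | zero =>
    obtain ⟨i, rfl⟩ := Nat.exists_eq_succ_of_ne_zero hi.ne'
    have h0 : fwdDiff h φ = fun _ => 0 := by funext b; simp [fwdDiff, hφ h b]
    rw [Function.iterate_succ_apply, h0]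
    clear h0 hi
    induction i with
    | zero => rfl
    | succ i ih => rw [Function.iterate_succ_apply', ih]; funext b; simp [fwdDiff]
  | succ m ih =>
    obtain ⟨i, rfl⟩ := Nat.exists_eq_succ_of_ne_zero (by omega : i ≠ 0)
    rw [Function.iterate_succ_apply]
    exact ih (hφ h) (by omega)

theorem exists_polynomial_eval_eq_choose (i : ℕ) :
    ∃ p : Polynomial ℂ, ∀ k : ℕ, p.eval (k : ℂ) = (k.choose i : ℂ) := by
  refine ⟨Polynomial.C ((i.factorial : ℂ)⁻¹) * descPochhammer ℂ i, fun k => ?_⟩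
  have : (i.factorial : ℂ) ≠ 0 := by exact_mod_cast i.factorial_ne_zero
  rw [Polynomial.eval_mul, Polynomial.eval_C, descPochhammer_eval_eq_descFactorial,
    Nat.descFactorial_eq_factorial_mul_choose]
  push_cast
  field_simp

/-- A polynomial function is a polynomial in the multiplicities of finitely many elements. This is
the Gregory-Newton formula, applied to one element at a time. -/
theorem IsPolyFun.exists_eval_sum_nsmul {n : ℕ} {m : ℕ} {φ : M → ℂ} (hφ : IsPolyFun m φ)
    (g : Fin n → M) (T : Finset (Fin n)) :
    ∃ q : MvPolynomial (Fin n) ℂ, ∀ k : Fin n → ℕ,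
      φ (∑ j ∈ T, k j • g j) = MvPolynomial.eval (fun j => (k j : ℂ)) q := by
  classical
  induction T using Finset.induction_on generalizing φ with
  | empty => exact ⟨MvPolynomial.C (φ 0), fun k => by simp⟩
  | insert a T ha ih =>
    choose q hq using fun i : ℕ => ih (hφ.fwdDiff_iter (g a) i)
    choose p hp using exists_polynomial_eval_eq_choose
    refine ⟨∑ i ∈ Finset.range (m + 1), Polynomial.aeval (MvPolynomial.X a) (p i) * q i,
      fun k => ?_⟩
    rw [Finset.sum_insert ha, add_comm, shift_eq_sum_fwdDiff_iter (g a) φ]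
    have h1 : ∀ N, N ≥ m + 1 → N ≥ k a + 1 →
        ∑ i ∈ Finset.range (k a + 1), (k a).choose i • (fwdDiff (g a))^[i] φ (∑ j ∈ T, k j • g j) =
        ∑ i ∈ Finset.range (m + 1), (k a).choose i • (fwdDiff (g a))^[i] φ (∑ j ∈ T, k j • g j) := by
      intro N hNm hNk
      trans ∑ i ∈ Finset.range N, (k a).choose i • (fwdDiff (g a))^[i] φ (∑ j ∈ T, k j • g j)
      · refine Finset.sum_subset (Finset.range_mono hNk) fun i _ hi => ?_
        rw [Nat.choose_eq_zero_of_lt (by simpa using hi), zero_smul]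
      · refine (Finset.sum_subset (Finset.range_mono hNm) fun i _ hi => ?_).symm
        rw [hφ.fwdDiff_iter_eq_zero (g a) (i := i) (by simpa using hi)]
        simp
    rw [h1 _ (le_max_left _ _) (le_max_right _ _), map_sum]
    refine Finset.sum_congr rfl fun i _ => ?_
    rw [map_mul, ← hq, nsmul_eq_mul, ← hp i (k a)]
    congr 1
    have := Polynomial.aeval_algHom_apply (MvPolynomial.aeval (R := ℂ) fun j => (k j : ℂ))
      (MvPolynomial.X a) (p i)
    rw [MvPolynomial.aeval_X] at this
    exact this

end PolynomialFunctions

/-! ### Polynomials on the semigroup and on its facets -/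

section Density

variable {d n : ℕ} {A : Fin n → Fin d → ℤ}

/-- The polynomial `x ↦ p (x + c)`. -/
noncomputable def shiftPoly {τ : Type*} (c : τ → ℂ) (p : MvPolynomial τ ℂ) : MvPolynomial τ ℂ :=
  MvPolynomial.aeval (fun i => MvPolynomial.X i + MvPolynomial.C (c i)) p

theorem eval_aeval_poly {τ υ : Type*} (x : υ → ℂ) (f : τ → MvPolynomial υ ℂ)
    (p : MvPolynomial τ ℂ) :
    MvPolynomial.eval x (MvPolynomial.aeval f p) =
      MvPolynomial.eval (fun i => MvPolynomial.eval x (f i)) p := by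
  have h : (MvPolynomial.aeval x : MvPolynomial υ ℂ →ₐ[ℂ] ℂ).comp (MvPolynomial.aeval f) =
      MvPolynomial.aeval fun i => MvPolynomial.eval x (f i) := by
    ext i
    simp [MvPolynomial.aeval_eq_eval]
  exact DFunLike.congr_fun h p

@[simp] theorem eval_shiftPoly {τ : Type*} (c x : τ → ℂ) (p : MvPolynomial τ ℂ) :
    MvPolynomial.eval x (shiftPoly c p) = MvPolynomial.eval (x + c) p := by
  rw [shiftPoly, eval_aeval_poly]
  congr 2
  funext i
  simp

theorem eq_zero_of_eval_nat {τ : Type*} (K : τ → ℕ) (q : MvPolynomial τ ℂ)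
    (h : ∀ k : τ → ℕ, (∀ j, K j ≤ k j) → MvPolynomial.eval (fun j => (k j : ℂ)) q = 0) :
    q = 0 := by
  refine MvPolynomial.funext_set (fun j => (fun m : ℕ => (m : ℂ)) '' Set.Ici (K j))
    (fun j => (Set.Ici_infinite (K j)).image Nat.cast_injective.injOn) fun x hx => ?_
  choose k hk hkx using fun j => hx j trivial
  obtain rfl : (fun j => (k j : ℂ)) = x := funext hkx
  rw [h k hk, map_zero]

theorem mem_NA_iff (x : Fin d → ℤ) : x ∈ NA A ↔ ∃ k : Fin n → ℕ, x = ∑ j, k j • A j := by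
  constructor
  · intro hx
    induction hx using AddSubmonoid.closure_induction with
    | mem x hx =>
      classical
      obtain ⟨j, rfl⟩ := hx
      exact ⟨Pi.single j 1, by simp [Pi.single_apply, ite_smul]⟩
    | zero => exact ⟨0, by simp⟩
    | add x y _ _ hx hy =>
      obtain ⟨k, rfl⟩ := hx
      obtain ⟨l, rfl⟩ := hy
      exact ⟨k + l, by simp [add_smul, Finset.sum_add_distrib]⟩
  · rintro ⟨k, rfl⟩
    exact sum_mem fun j _ => nsmul_mem (mem_NA j) _

theorem exists_zsmul_eq (hA : AddSubgroup.closure (Set.range A) = ⊤) (x : Fin d → ℤ) :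
    ∃ w : Fin n → ℤ, x = ∑ j, w j • A j := by
  have hx : x ∈ AddSubgroup.closure (Set.range A) := by rw [hA]; trivial
  induction hx using AddSubgroup.closure_induction with
  | mem x hx =>
    classical
    obtain ⟨j, rfl⟩ := hx
    exact ⟨Pi.single j 1, by simp [Pi.single_apply, ite_smul]⟩
  | zero => exact ⟨0, by simp⟩
  | add x y _ _ hx hy =>
    obtain ⟨k, rfl⟩ := hx
    obtain ⟨l, rfl⟩ := hy
    exact ⟨k + l, by simp [add_smul, Finset.sum_add_distrib]⟩
  | neg x _ hx =>
    obtain ⟨k, rfl⟩ := hx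
    exact ⟨-k, by simp⟩

/-- A polynomial function on `ℕA` is the restriction of a polynomial on `ℂ^d`: its pull-back to
`ℕ^n` is a polynomial invariant under all integral relations among the `a_j`, so that it can be
composed with an integral section of `ℤ^n → ℤ^d`. -/
theorem IsPolyFun.exists_mvPolynomial (hA : AddSubgroup.closure (Set.range A) = ⊤) {m : ℕ}
    {φ : NA A → ℂ} (hφ : IsPolyFun m φ) :
    ∃ p : MvPolynomial (Fin d) ℂ, ∀ b : NA A, φ b = MvPolynomial.eval (toC b.1) p := by
  classical
  obtain ⟨q, hq⟩ := hφ.exists_eval_sum_nsmul (fun j => (⟨A j, mem_NA j⟩ : NA A)) Finset.univ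
  have hcoe : ∀ k : Fin n → ℕ, ((∑ j, k j • (⟨A j, mem_NA j⟩ : NA A) : NA A) : Fin d → ℤ) =
      ∑ j, k j • A j := fun k => by
    rw [AddSubmonoid.coe_finsetSum]; rfl
  choose w hw using fun i : Fin d => exists_zsmul_eq hA (Pi.single i 1)
  have hinv : ∀ u : Fin n → ℤ, ∑ j, u j • A j = 0 →
      shiftPoly (fun j => (u j : ℂ)) q - q = 0 := by
    intro u hu
    refine eq_zero_of_eval_nat (fun j => (u j).natAbs) _ fun k hk => ?_
    have hnn : ∀ j, 0 ≤ (k j : ℤ) + u j := fun j => by have := hk j; omega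
    have h1 : (fun j => (k j : ℂ)) + (fun j => (u j : ℂ)) =
        fun j => ((((k j : ℤ) + u j).toNat : ℕ) : ℂ) := by
      funext j
      have h2 : ((((k j : ℤ) + u j).toNat : ℤ) : ℂ) = (((k j : ℤ) + u j : ℤ) : ℂ) := by
        rw [Int.toNat_of_nonneg (hnn j)]
      push_cast at h2
      exact h2.symm
    rw [map_sub, eval_shiftPoly, h1, ← hq, ← hq, sub_eq_zero]
    congr 1
    apply Subtype.ext
    rw [hcoe, hcoe]
    have h3 : ∀ j, ((k j : ℤ) + u j).toNat • A j = k j • A j + u j • A j := fun j => by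
      rw [← natCast_zsmul, Int.toNat_of_nonneg (hnn j), add_smul, natCast_zsmul]
    simp only [h3, Finset.sum_add_distrib, hu, add_zero]
  refine ⟨MvPolynomial.aeval
    (fun j => ∑ i, MvPolynomial.C (w i j : ℂ) * MvPolynomial.X i) q, fun b => ?_⟩
  obtain ⟨k, hk⟩ := (mem_NA_iff b.1).1 b.2
  let u : Fin n → ℤ := fun j => ∑ i, b.1 i * w i j - k j
  have hu : ∑ j, u j • A j = 0 := by
    simp only [u, sub_smul, Finset.sum_sub_distrib, natCast_zsmul, ← hk, sub_eq_zero,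
      Finset.sum_smul, mul_smul]
    rw [Finset.sum_comm]
    simp only [← Finset.smul_sum, ← hw]
    ext i
    simp [Finset.sum_apply, Pi.single_apply]
  have hb : b = ∑ j, k j • (⟨A j, mem_NA j⟩ : NA A) := Subtype.ext (by rw [hcoe]; exact hk)
  have h4 := congrArg (MvPolynomial.eval fun j => (k j : ℂ)) (hinv u hu)
  rw [map_sub, eval_shiftPoly, map_zero, sub_eq_zero] at h4
  rw [eval_aeval_poly, hb, hq, ← h4, ← hb]
  congr 2
  funext j
  simp only [Pi.add_apply, u, map_sum, map_mul, MvPolynomial.eval_C, MvPolynomial.eval_X, toC]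
  push_cast
  rw [add_sub_cancel]
  exact Finset.sum_congr rfl fun i _ => mul_comm _ _

theorem eval_eq_zero_of_mem_span (p : MvPolynomial (Fin d) ℂ) (s : Fin d → ℂ) (T : Set (Fin n))
    [Fintype T] (h : ∀ k : T → ℕ, MvPolynomial.eval (s + toC (∑ j, k j • A j)) p = 0)
    (v : Fin d → ℂ) (hv : v ∈ Submodule.span ℂ ((fun j => toC (A j)) '' T)) :
    MvPolynomial.eval (s + v) p = 0 := by
  classical
  rw [Set.image_eq_range] at hv
  obtain ⟨z, rfl⟩ := (Submodule.mem_span_range_iff_exists_fun ℂ).1 hv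
  let q : MvPolynomial T ℂ := MvPolynomial.aeval
    (fun i => MvPolynomial.C (s i) + ∑ j : T, MvPolynomial.C (A j i : ℂ) * MvPolynomial.X j) p
  have hq : ∀ x : T → ℂ, MvPolynomial.eval x q =
      MvPolynomial.eval (s + ∑ j : T, x j • toC (A j)) p := by
    intro x
    rw [eval_aeval_poly]
    congr 2
    funext i
    simp only [map_add, MvPolynomial.eval_C, map_sum, map_mul, MvPolynomial.eval_X, Pi.add_apply,
      Finset.sum_apply, Pi.smul_apply, smul_eq_mul, toC, mul_comm]
  have hq0 : q = 0 := eq_zero_of_eval_nat (fun _ => 0) q fun k _ => by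
    rw [hq, ← h k]
    congr 3
    funext i
    simp [toC, Finset.sum_apply]
  rw [← hq, hq0, map_zero]

theorem ofReal_mem_span {T : Set (Fin n)} {v : Fin d → ℝ}
    (hv : v ∈ Submodule.span ℝ ((fun j => toReal (A j)) '' T)) :
    (fun i => (v i : ℂ)) ∈ Submodule.span ℂ ((fun j => toC (A j)) '' T) := by
  induction hv using Submodule.span_induction with
  | mem x hx =>
    obtain ⟨j, hj, rfl⟩ := hx
    refine Submodule.subset_span ⟨j, hj, ?_⟩
    funext i; simp [toC, toReal]
  | zero =>
    convert Submodule.zero_mem (Submodule.span ℂ ((fun j => toC (A j)) '' T)) using 1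
    funext i; simp
  | add x y _ _ hx hy => convert add_mem hx hy using 1; funext i; simp
  | smul a x _ hx =>
    convert Submodule.smul_mem _ (a : ℂ) hx using 1; funext i; simp

theorem eq_re_add_im (β : Fin d → ℂ) :
    β = (fun i => (((β i).re : ℝ) : ℂ)) + Complex.I • fun i => (((β i).im : ℝ) : ℂ) := by
  funext i
  simp [mul_comm Complex.I]

theorem eq_zero_of_eval_NA (hA : AddSubgroup.closure (Set.range A) = ⊤)
    (p : MvPolynomial (Fin d) ℂ) (h : ∀ b ∈ NA A, MvPolynomial.eval (toC b) p = 0) : p = 0 := by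
  classical
  refine MvPolynomial.funext fun β => ?_
  have hmem : ∀ v : Fin d → ℝ,
      v ∈ Submodule.span ℝ ((fun j => toReal (A j)) '' Set.univ) := fun v => by
    rw [Set.image_univ, span_toReal hA]; trivial
  have hβ : β ∈ Submodule.span ℂ ((fun j => toC (A j)) '' Set.univ) := by
    rw [eq_re_add_im β]
    exact add_mem (ofReal_mem_span (hmem _)) (Submodule.smul_mem _ _ (ofReal_mem_span (hmem _)))
  rw [map_zero, ← zero_add β]
  refine eval_eq_zero_of_mem_span p 0 Set.univ (fun k => ?_) β hβ
  rw [zero_add]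
  exact h _ (sum_mem fun j _ => nsmul_mem (mem_NA _) _)

/-- A polynomial vanishing on the translate by `s` of the part of `ℕA` lying in a facet `σ`
vanishes on the whole complex hyperplane `F_σ = F_σ(s)`. -/
theorem eval_eq_zero_of_facet (hA : AddSubgroup.closure (Set.range A) = ⊤) (σ : Facet A)
    (p : MvPolynomial (Fin d) ℂ) (s : Fin d → ℤ)
    (h : ∀ u ∈ NA A, suppZ σ u = 0 → MvPolynomial.eval (toC (s + u)) p = 0)
    (β : Fin d → ℂ) (hβ : suppC A σ β = suppZ σ s) : MvPolynomial.eval β p = 0 := by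
  classical
  have hv : suppC A σ (β - toC s) = 0 := by
    have := suppC_add σ (β - toC s) (toC s)
    rw [sub_add_cancel, hβ, suppC_toC hA] at this
    simpa using this.symm
  rw [suppC_apply hA] at hv
  have hre : supp A σ (fun i => ((β - toC s) i).re) = 0 := by
    rw [supp_apply hA]
    simpa using congrArg Complex.re hv
  have him : supp A σ (fun i => ((β - toC s) i).im) = 0 := by
    rw [supp_apply hA]
    simpa using congrArg Complex.im hv
  have hmem : β - toC s ∈ Submodule.span ℂ
      ((fun j => toC (A j)) '' {j | supp A σ (toReal (A j)) = 0}) := by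
    rw [eq_re_add_im (β - toC s)]
    exact add_mem (ofReal_mem_span (mem_span_of_supp_eq_zero hA σ hre))
      (Submodule.smul_mem _ _ (ofReal_mem_span (mem_span_of_supp_eq_zero hA σ him)))
  rw [← add_sub_cancel (toC s) β]
  refine eval_eq_zero_of_mem_span p (toC s) _ (fun k => ?_) _ hmem
  rw [← toC_add]
  refine h _ (sum_mem fun j _ => nsmul_mem (mem_NA _) _) ?_
  rw [map_sum]
  refine Finset.sum_eq_zero fun j _ => ?_
  have hj : supp A σ (toReal (A j)) = 0 := j.2
  rw [supp_toReal hA] at hj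
  rw [map_nsmul, show suppZ σ (A j) = 0 by exact_mod_cast hj, smul_zero]

end Density

/-! ### Monomials and coefficients in the semigroup algebra -/

section Monomials

variable {d n : ℕ} {A : Fin n → Fin d → ℤ}

variable (A) in
open Classical in
/-- The monomial `t^x` of `R_A`; by convention it is `0` when `x ∉ ℕA`. -/
noncomputable def mon (x : Fin d → ℤ) : RA A :=
  if h : x ∈ NA A then AddMonoidAlgebra.single ⟨x, h⟩ 1 else 0

variable (A) in
open Classical in
/-- The coefficient of `t^x` in an element of `R_A`; it is `0` when `x ∉ ℕA`. -/
noncomputable def cf (x : Fin d → ℤ) : RA A →ₗ[ℂ] ℂ :=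
  if h : x ∈ NA A then
    Finsupp.lapply (⟨x, h⟩ : NA A) ∘ₗ (AddMonoidAlgebra.coeffLinearEquiv ℂ).toLinearMap
  else 0

theorem mon_of_mem {x : Fin d → ℤ} (h : x ∈ NA A) :
    mon A x = AddMonoidAlgebra.single (⟨x, h⟩ : NA A) 1 := dif_pos h

theorem mon_of_notMem {x : Fin d → ℤ} (h : x ∉ NA A) : mon A x = 0 := dif_neg h

theorem cf_of_mem {x : Fin d → ℤ} (h : x ∈ NA A) (f : RA A) :
    cf A x f = f.coeff (⟨x, h⟩ : NA A) := by
  rw [cf, dif_pos h]; rfl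

theorem cf_of_notMem {x : Fin d → ℤ} (h : x ∉ NA A) (f : RA A) : cf A x f = 0 := by
  rw [cf, dif_neg h]; rfl

theorem cf_mon {x y : Fin d → ℤ} (hy : y ∈ NA A) [Decidable (x = y)] :
    cf A x (mon A y) = if x = y then 1 else 0 := by
  classical
  by_cases hx : x ∈ NA A
  · rw [cf_of_mem hx, mon_of_mem hy, AddMonoidAlgebra.coeff_single, Finsupp.single_apply]
    simp [eq_comm]
  · rw [cf_of_notMem hx, if_neg]
    rintro rfl; exact hx hy

theorem mon_mul_mon {x y : Fin d → ℤ} (hx : x ∈ NA A) (hy : y ∈ NA A) :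
    mon A x * mon A y = mon A (x + y) := by
  rw [mon_of_mem hx, mon_of_mem hy, mon_of_mem (add_mem hx hy), AddMonoidAlgebra.single_mul_single,
    one_mul]
  rfl

theorem mon_zero : mon A 0 = 1 := by
  rw [mon_of_mem (zero_mem _), AddMonoidAlgebra.one_def]
  rfl

theorem RA_induction {motive : RA A → Prop} (f : RA A) (zero : motive 0)
    (add : ∀ f g, motive f → motive g → motive (f + g))
    (smul : ∀ (c : ℂ), ∀ x ∈ NA A, motive (c • mon A x)) : motive f := by
  induction f using AddMonoidAlgebra.induction_linear with
  | zero => exact zero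
  | add f g hf hg => exact add f g hf hg
  | single x c =>
    have := smul c x.1 x.2
    rw [mon_of_mem x.2, AddMonoidAlgebra.smul_single, smul_eq_mul, mul_one] at this
    exact this

theorem linearMap_ext_mon {V : Type*} [AddCommGroup V] [Module ℂ V] {P Q : RA A →ₗ[ℂ] V}
    (h : ∀ x ∈ NA A, P (mon A x) = Q (mon A x)) : P = Q := by
  refine LinearMap.ext fun f => ?_
  induction f using RA_induction with
  | zero => simp
  | add f g hf hg => simp [hf, hg]
  | smul c x hx => simp [h x hx]

theorem ext_cf {f g : RA A} (h : ∀ x ∈ NA A, cf A x f = cf A x g) : f = g := by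
  apply AddMonoidAlgebra.coeff_injective
  ext x
  rw [← cf_of_mem x.2, ← cf_of_mem x.2, h x.1 x.2]

theorem finite_cf (f : RA A) : {x | cf A x f ≠ 0}.Finite := by
  refine (f.coeff.support.finite_toSet.image Subtype.val).subset fun x hx => ?_
  have hxS : x ∈ NA A := by
    by_contra h
    exact hx (cf_of_notMem h f)
  have hx' : cf A x f ≠ 0 := hx
  rw [cf_of_mem hxS] at hx'
  exact ⟨⟨x, hxS⟩, by simpa using hx', rfl⟩

theorem eq_sum_cf_smul_mon {f : RA A} (T : Finset (Fin d → ℤ)) (hT : ∀ x, cf A x f ≠ 0 → x ∈ T) :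
    f = ∑ x ∈ T, cf A x f • mon A x := by
  classical
  refine ext_cf fun y hy => ?_
  rw [map_sum, Finset.sum_eq_single y]
  · rw [map_smul, cf_mon hy, if_pos rfl, smul_eq_mul, mul_one]
  · intro x _ hxy
    by_cases hx : x ∈ NA A
    · rw [map_smul, cf_mon hx, if_neg hxy.symm, smul_zero]
    · rw [cf_of_notMem hx, zero_smul, map_zero]
  · intro h
    rw [not_imp_comm.1 (hT y) h, zero_smul, map_zero]

theorem cf_mon_mul {c : Fin d → ℤ} (hc : c ∈ NA A) (x : Fin d → ℤ) (f : RA A) :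
    cf A (c + x) (mon A c * f) = cf A x f := by
  classical
  have : cf A (c + x) ∘ₗ LinearMap.mulLeft ℂ (mon A c) = cf A x := by
    refine linearMap_ext_mon fun y hy => ?_
    rw [LinearMap.comp_apply, LinearMap.mulLeft_apply, mon_mul_mon hc hy, cf_mon hy,
      cf_mon (add_mem hc hy)]
    simp
  exact LinearMap.congr_fun this f

end Monomials

/-! ### Homogeneous differential operators -/

section Operators

variable {d n : ℕ} {A : Fin n → Fin d → ℤ}

/-- Multiplication by an element of `R_A`. -/
noncomputable abbrev mulOp (g : RA A) : Module.End ℂ (RA A) := LinearMap.mulLeft ℂ g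

/-- The commutator with the multiplication by an element of `R_A`. -/
noncomputable def br (g : RA A) (P : Module.End ℂ (RA A)) : Module.End ℂ (RA A) :=
  mulOp g * P - P * mulOp g

theorem br_apply (g : RA A) (P : Module.End ℂ (RA A)) (x : RA A) :
    br g P x = g * P x - P (g * x) := rfl

theorem comm_eq_br (f : MvPolynomial (Fin n) ℂ) (P : Module.End ℂ (RA A)) :
    comm ℂ (MvPolynomial (Fin n) ℂ) (RA A) f P = br (toRA A f) P := by
  refine LinearMap.ext fun x => ?_
  rw [comm_apply, br_apply, Algebra.smul_def, Algebra.smul_def]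
  rfl

theorem exists_toRA_eq_mon {x : Fin d → ℤ} (hx : x ∈ NA A) : ∃ f, toRA A f = mon A x := by
  induction hx using AddSubmonoid.closure_induction with
  | mem x hx =>
    obtain ⟨j, rfl⟩ := hx
    exact ⟨MvPolynomial.X j, by rw [toRA, MvPolynomial.aeval_X, mon_of_mem (mem_NA j)]⟩
  | zero => exact ⟨1, by rw [map_one, mon_zero]⟩
  | add x y hx hy ihx ihy =>
    obtain ⟨f, hf⟩ := ihx
    obtain ⟨g, hg⟩ := ihy
    exact ⟨f * g, by rw [map_mul, hf, hg, mon_mul_mon hx hy]⟩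

theorem toRA_surjective : Function.Surjective (toRA A) := by
  intro g
  induction g using RA_induction with
  | zero => exact ⟨0, map_zero _⟩
  | add f g hf hg =>
    obtain ⟨p, rfl⟩ := hf
    obtain ⟨q, rfl⟩ := hg
    exact ⟨p + q, map_add _ _ _⟩
  | smul c x hx =>
    obtain ⟨p, hp⟩ := exists_toRA_eq_mon hx
    exact ⟨c • p, by rw [map_smul, hp]⟩

variable (A) in
/-- Differential operators of order at most `m` on `R_A`. -/
abbrev IsOrderLE (m : ℕ) (P : Module.End ℂ (RA A)) : Prop :=
  IsDiffOp ℂ (MvPolynomial (Fin n) ℂ) (RA A) m P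

theorem isOrderLE_zero_iff {P : Module.End ℂ (RA A)} :
    IsOrderLE A 0 P ↔ ∀ g, br g P = 0 := by
  constructor
  · intro h g
    obtain ⟨f, rfl⟩ := toRA_surjective g
    rw [← comm_eq_br]
    exact comm_eq_zero h f
  · intro h f x
    have := LinearMap.congr_fun (h (toRA A f)) x
    rw [br_apply, LinearMap.zero_apply, sub_eq_zero] at this
    rw [Algebra.smul_def, Algebra.smul_def]
    exact this.symm

theorem isOrderLE_succ_iff {m : ℕ} {P : Module.End ℂ (RA A)} :
    IsOrderLE A (m + 1) P ↔ ∀ g, IsOrderLE A m (br g P) := by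
  constructor
  · intro h g
    obtain ⟨f, rfl⟩ := toRA_surjective g
    rw [← comm_eq_br]
    exact h f
  · intro h f
    rw [comm_eq_br]
    exact h _

theorem IsOrderLE.smul {m : ℕ} {P : Module.End ℂ (RA A)} (hP : IsOrderLE A m P) (c : ℂ) :
    IsOrderLE A m (c • P) := by
  have := IsDiffOp.mul (isDiffOp_algebraMap c) hP
  rwa [zero_add, ← Algebra.smul_def] at this

theorem br_add (f g : RA A) (P : Module.End ℂ (RA A)) : br (f + g) P = br f P + br g P := by
  refine LinearMap.ext fun x => ?_
  simp only [br_apply, LinearMap.add_apply, add_mul, map_add]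
  abel

theorem br_smul (c : ℂ) (g : RA A) (P : Module.End ℂ (RA A)) : br (c • g) P = c • br g P := by
  refine LinearMap.ext fun x => ?_
  simp only [br_apply, LinearMap.smul_apply, smul_mul_assoc, map_smul, smul_sub]

theorem br_zero (P : Module.End ℂ (RA A)) : br 0 P = 0 := by
  refine LinearMap.ext fun x => ?_
  simp [br_apply]

theorem isOrderLE_zero_of_mon {P : Module.End ℂ (RA A)} (h : ∀ x ∈ NA A, br (mon A x) P = 0) :
    IsOrderLE A 0 P := by
  refine isOrderLE_zero_iff.2 fun g => ?_
  induction g using RA_induction with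
  | zero => exact br_zero P
  | add f g hf hg => rw [br_add, hf, hg, add_zero]
  | smul c x hx => rw [br_smul, h x hx, smul_zero]

theorem isOrderLE_succ_of_mon {m : ℕ} {P : Module.End ℂ (RA A)}
    (h : ∀ x ∈ NA A, IsOrderLE A m (br (mon A x) P)) : IsOrderLE A (m + 1) P := by
  refine isOrderLE_succ_iff.2 fun g => ?_
  induction g using RA_induction with
  | zero => rw [br_zero]; exact isDiffOp_zero m
  | add f g hf hg => rw [br_add]; exact hf.add hg
  | smul c x hx => rw [br_smul]; exact IsOrderLE.smul (h x hx) c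

theorem mulOp_mem (g : RA A) : mulOp g ∈ DRA A := by
  refine ⟨0, isOrderLE_zero_iff.2 fun f => ?_⟩
  refine LinearMap.ext fun x => ?_
  rw [br_apply, LinearMap.mulLeft_apply, LinearMap.mulLeft_apply, mul_left_comm, sub_self]
  rfl

/-- The homogeneous operator of degree `a` with `t^b ↦ φ(b) t^{a+b}`; a term whose exponent
`a + b` is not in `ℕA` is dropped. -/
noncomputable def homOp (a : Fin d → ℤ) (φ : NA A → ℂ) : Module.End ℂ (RA A) :=
  Finsupp.linearCombination ℂ (fun b : NA A => φ b • mon A (a + b.1)) ∘ₗ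
    (AddMonoidAlgebra.coeffLinearEquiv ℂ).toLinearMap

theorem homOp_mon (a : Fin d → ℤ) (φ : NA A → ℂ) {b : Fin d → ℤ} (hb : b ∈ NA A) :
    homOp a φ (mon A b) = φ ⟨b, hb⟩ • mon A (a + b) := by
  rw [mon_of_mem hb]
  have : (AddMonoidAlgebra.coeffLinearEquiv ℂ) (AddMonoidAlgebra.single (⟨b, hb⟩ : NA A) (1 : ℂ))
      = Finsupp.single (⟨b, hb⟩ : NA A) (1 : ℂ) := rfl
  simp only [homOp, LinearMap.comp_apply, LinearEquiv.coe_coe, this,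
    Finsupp.linearCombination_single, one_smul]

theorem br_mon_homOp {a c : Fin d → ℤ} {φ : NA A → ℂ} (hφ : ∀ b : NA A, a + b.1 ∉ NA A → φ b = 0)
    (hc : c ∈ NA A) :
    br (mon A c) (homOp a φ) = homOp (a + c) fun b => -(φ (b + ⟨c, hc⟩) - φ b) := by
  refine linearMap_ext_mon fun b hb => ?_
  rw [br_apply, homOp_mon a φ hb, mon_mul_mon hc hb, homOp_mon a φ (add_mem hc hb),
    homOp_mon _ _ hb]
  have hbc : (⟨c + b, add_mem hc hb⟩ : NA A) = ⟨b, hb⟩ + ⟨c, hc⟩ := Subtype.ext (add_comm c b)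
  have h1 : φ ⟨b, hb⟩ • (mon A c * mon A (a + b)) = φ ⟨b, hb⟩ • mon A (a + c + b) := by
    by_cases h : a + b ∈ NA A
    · rw [mon_mul_mon hc h]
      congr 2
      abel
    · rw [hφ ⟨b, hb⟩ h, zero_smul, zero_smul]
  rw [mul_smul_comm, h1, hbc, ← add_assoc, ← sub_smul, neg_sub]

theorem IsPolyFun.neg {M : Type*} [AddCommMonoid M] {m : ℕ} {φ : M → ℂ} (hφ : IsPolyFun m φ) :
    IsPolyFun m fun b => -φ b := by
  simpa using (isPolyFun_const 0 (-1)).mul hφ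

theorem isOrderLE_homOp {m : ℕ} {a : Fin d → ℤ} {φ : NA A → ℂ} (hm : IsPolyFun m φ)
    (hφ : ∀ b : NA A, a + b.1 ∉ NA A → φ b = 0) : IsOrderLE A m (homOp a φ) := by
  have key : ∀ c (hc : c ∈ NA A) (b : NA A), a + c + b.1 ∉ NA A →
      -(φ (b + ⟨c, hc⟩) - φ b) = 0 := by
    intro c hc b hb
    have h1 : φ b = 0 := hφ b fun h => hb (by
      rw [add_right_comm]; exact add_mem h hc)
    have h2 : φ (b + ⟨c, hc⟩) = 0 := hφ _ fun h => hb (by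
      have : a + c + b.1 = a + (b.1 + c) := by abel
      rw [this]; exact h)
    rw [h1, h2, sub_self, neg_zero]
  induction m generalizing a φ with
  | zero =>
    refine isOrderLE_zero_of_mon fun c hc => ?_
    rw [br_mon_homOp hφ hc]
    refine linearMap_ext_mon fun b hb => ?_
    rw [homOp_mon _ _ hb, hm ⟨c, hc⟩ ⟨b, hb⟩, sub_self, neg_zero, zero_smul]
    rfl
  | succ m ih =>
    refine isOrderLE_succ_of_mon fun c hc => ?_
    rw [br_mon_homOp hφ hc]
    refine ih (hm ⟨c, hc⟩).neg (key c hc) fun c' hc' b hb => ?_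
    have h1 := key c hc b fun h => hb (by
      rw [add_right_comm]; exact add_mem h hc')
    have h2 := key c hc (b + ⟨c', hc'⟩) fun h => hb (by
      have : a + c + c' + b.1 = a + c + (b.1 + c') := by abel
      rw [this]; exact h)
    rw [h1, h2, sub_self, neg_zero]

theorem exists_isPolyFun_eval (p : MvPolynomial (Fin d) ℂ) :
    ∃ m, IsPolyFun m fun b : NA A => MvPolynomial.eval (toC b.1) p := by
  induction p using MvPolynomial.induction_on with
  | C z => exact ⟨0, by simpa using isPolyFun_const 0 z⟩
  | add p q hp hq =>
    obtain ⟨m, hm⟩ := hp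
    obtain ⟨k, hk⟩ := hq
    exact ⟨max m k, by
      simpa using (hm.mono (le_max_left m k)).add (hk.mono (le_max_right m k))⟩
  | mul_X p i hp =>
    obtain ⟨m, hm⟩ := hp
    have hX : IsPolyFun 1 fun b : NA A => toC b.1 i := by
      intro c
      simpa using isPolyFun_const 0 (toC c.1 i)
    exact ⟨m + 1, by simpa using hm.mul hX⟩

variable (A) in
/-- The operator `t^a p(θ)` with `t^b ↦ p(b) t^{a+b}`; a term whose exponent `a + b` is not in
`ℕA` is dropped. -/
noncomputable def tOp (a : Fin d → ℤ) (p : MvPolynomial (Fin d) ℂ) : Module.End ℂ (RA A) :=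
  homOp a fun b => MvPolynomial.eval (toC b.1) p

theorem tOp_mon (a : Fin d → ℤ) (p : MvPolynomial (Fin d) ℂ) {b : Fin d → ℤ} (hb : b ∈ NA A) :
    tOp A a p (mon A b) = MvPolynomial.eval (toC b) p • mon A (a + b) := homOp_mon _ _ hb

theorem tOp_mem {a : Fin d → ℤ} {p : MvPolynomial (Fin d) ℂ}
    (h : ∀ b ∈ NA A, a + b ∉ NA A → MvPolynomial.eval (toC b) p = 0) : tOp A a p ∈ DRA A := by
  obtain ⟨m, hm⟩ := exists_isPolyFun_eval (A := A) p
  exact ⟨m, isOrderLE_homOp hm fun b hb => h b.1 b.2 hb⟩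

theorem tOp_zero_mem (p : MvPolynomial (Fin d) ℂ) : tOp A 0 p ∈ DRA A :=
  tOp_mem fun b hb h => absurd (by rwa [zero_add]) h

end Operators

/-! ### Symbols of differential operators -/

section Symbols

variable {d n : ℕ} {A : Fin n → Fin d → ℤ}

theorem cf_apply_mon_add_sub {P : Module.End ℂ (RA A)} (a : Fin d → ℤ) (b c : NA A) :
    cf A (a + (b + c : NA A).1) (P (mon A (b + c : NA A).1)) - cf A (a + b.1) (P (mon A b.1)) =
      -cf A (a + c.1 + b.1) (br (mon A c.1) P (mon A b.1)) := by
  have h1 : mon A (b + c : NA A).1 = mon A c.1 * mon A b.1 := by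
    rw [mon_mul_mon c.2 b.2, add_comm c.1 b.1]; rfl
  have h2 : a + (b + c : NA A).1 = a + c.1 + b.1 := by
    rw [AddSubmonoid.coe_add]; abel
  have h3 : a + c.1 + b.1 = c.1 + (a + b.1) := by abel
  rw [br_apply, map_sub, ← h1, h2]
  nth_rewrite 2 [h3]
  rw [cf_mon_mul c.2]
  ring

/-- The matrix coefficients of a differential operator along a fixed degree form a polynomial
function on `ℕA`. -/
theorem IsOrderLE.isPolyFun {m : ℕ} {P : Module.End ℂ (RA A)} (hP : IsOrderLE A m P)
    (a : Fin d → ℤ) : IsPolyFun m fun b : NA A => cf A (a + b.1) (P (mon A b.1)) := by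
  induction m generalizing P a with
  | zero =>
    intro c b
    have := cf_apply_mon_add_sub (P := P) a b c
    rw [isOrderLE_zero_iff.1 hP, LinearMap.zero_apply, map_zero, neg_zero, sub_eq_zero] at this
    exact this
  | succ m ih =>
    intro c
    simp only [cf_apply_mon_add_sub]
    exact (ih (isOrderLE_succ_iff.1 hP _) _).neg

theorem IsOrderLE.finite_degrees {m : ℕ} {P : Module.End ℂ (RA A)} (hP : IsOrderLE A m P) :
    {a | ∃ b : NA A, cf A (a + b.1) (P (mon A b.1)) ≠ 0}.Finite := by
  have hsub : ∀ P : Module.End ℂ (RA A),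
      {a | ∃ b : NA A, cf A (a + b.1) (P (mon A b.1)) ≠ 0} ⊆ {a | cf A a (P (mon A 0)) ≠ 0} ∪
        ⋃ j, (fun a => a + A j) ⁻¹'
          {a | ∃ b : NA A, cf A (a + b.1) (br (mon A (A j)) P (mon A b.1)) ≠ 0} := by
    intro P a ha
    by_contra hnot
    simp only [Set.mem_union, Set.mem_iUnion, Set.mem_preimage, Set.mem_ofPred_eq, not_or,
      not_exists, not_not] at hnot
    obtain ⟨h0, hj⟩ := hnot
    obtain ⟨⟨b, hb⟩, hab⟩ := ha
    refine hab ?_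
    clear hab
    have hstep : ∀ c ∈ NA A, ∀ b : NA A, cf A (a + (b.1 + c)) (P (mon A (b.1 + c))) =
        cf A (a + b.1) (P (mon A b.1)) := by
      intro c hc
      induction hc using AddSubmonoid.closure_induction with
      | mem x hx =>
        intro b
        obtain ⟨j, rfl⟩ := hx
        have h1 := cf_apply_mon_add_sub (P := P) a b ⟨A j, mem_NA j⟩
        rw [hj j b, neg_zero, sub_eq_zero] at h1
        exact h1
      | zero => intro b; simp
      | add x y hx hy ihx ihy =>
        intro b
        have := ihy (b + ⟨x, hx⟩)
        rw [AddSubmonoid.coe_add] at this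
        rw [← add_assoc b.1 x y, this]
        exact ihx b
    have := hstep b hb 0
    simp only [AddSubmonoid.coe_zero, zero_add, add_zero] at this
    rw [this, h0]
  induction m generalizing P with
  | zero =>
    refine ((finite_cf (P (mon A 0))).union (Set.finite_iUnion fun j => ?_)).subset (hsub P)
    rw [isOrderLE_zero_iff.1 hP]
    simp
  | succ m ih =>
    refine ((finite_cf (P (mon A 0))).union (Set.finite_iUnion fun j => ?_)).subset (hsub P)
    exact (ih (isOrderLE_succ_iff.1 hP _)).preimage (add_left_injective _).injOn

/-- The symbol of degree `a` of a differential operator `P`: the polynomial `p_a` such that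
`t^a p_a(θ)` is the component of `P` of degree `a`. -/
noncomputable def symb (P : Module.End ℂ (RA A)) (a : Fin d → ℤ) : MvPolynomial (Fin d) ℂ :=
  Classical.epsilon fun p => ∀ b : NA A, cf A (a + b.1) (P (mon A b.1)) =
    MvPolynomial.eval (toC b.1) p

theorem eval_symb (hA : AddSubgroup.closure (Set.range A) = ⊤) {P : Module.End ℂ (RA A)}
    (hP : P ∈ DRA A) (a : Fin d → ℤ) {b : Fin d → ℤ} (hb : b ∈ NA A) :
    MvPolynomial.eval (toC b) (symb P a) = cf A (a + b) (P (mon A b)) := by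
  obtain ⟨m, hm⟩ := hP
  obtain ⟨p, hp⟩ := (IsOrderLE.isPolyFun hm a).exists_mvPolynomial hA
  exact (Classical.epsilon_spec (p := fun p => ∀ b : NA A, cf A (a + b.1) (P (mon A b.1)) =
    MvPolynomial.eval (toC b.1) p) ⟨p, hp⟩ ⟨b, hb⟩).symm

theorem symb_eq (hA : AddSubgroup.closure (Set.range A) = ⊤) {P : Module.End ℂ (RA A)}
    (hP : P ∈ DRA A) (a : Fin d → ℤ) {p : MvPolynomial (Fin d) ℂ}
    (h : ∀ b ∈ NA A, cf A (a + b) (P (mon A b)) = MvPolynomial.eval (toC b) p) :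
    symb P a = p := by
  rw [← sub_eq_zero]
  refine eq_zero_of_eval_NA hA _ fun b hb => ?_
  rw [map_sub, eval_symb hA hP a hb, h b hb, sub_self]

theorem symb_add (hA : AddSubgroup.closure (Set.range A) = ⊤) {P Q : Module.End ℂ (RA A)}
    (hP : P ∈ DRA A) (hQ : Q ∈ DRA A) (a : Fin d → ℤ) :
    symb (P + Q) a = symb P a + symb Q a :=
  symb_eq hA (add_mem hP hQ) a fun b hb => by
    rw [map_add, eval_symb hA hP a hb, eval_symb hA hQ a hb, LinearMap.add_apply, map_add]

theorem symb_neg (hA : AddSubgroup.closure (Set.range A) = ⊤) {P : Module.End ℂ (RA A)}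
    (hP : P ∈ DRA A) (a : Fin d → ℤ) : symb (-P) a = -symb P a :=
  symb_eq hA (neg_mem hP) a fun b hb => by
    rw [map_neg, eval_symb hA hP a hb, LinearMap.neg_apply, map_neg]

theorem symb_zero (hA : AddSubgroup.closure (Set.range A) = ⊤) (a : Fin d → ℤ) :
    symb (0 : Module.End ℂ (RA A)) a = 0 :=
  symb_eq hA (zero_mem _) a fun b _ => by simp

theorem symb_tOp (hA : AddSubgroup.closure (Set.range A) = ⊤) {c : Fin d → ℤ}
    {p : MvPolynomial (Fin d) ℂ}
    (h : ∀ b ∈ NA A, c + b ∉ NA A → MvPolynomial.eval (toC b) p = 0) (a : Fin d → ℤ)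
    [Decidable (a = c)] : symb (tOp A c p) a = if a = c then p else 0 := by
  classical
  refine symb_eq hA (tOp_mem h) a fun b hb => ?_
  rw [tOp_mon c p hb, map_smul]
  by_cases hc : c + b ∈ NA A
  · rw [cf_mon hc]
    by_cases hac : a = c
    · simp [hac]
    · simp [hac]
  · rw [mon_of_notMem hc, map_zero, smul_zero]
    split_ifs
    · rw [h b hb hc]
    · simp

theorem finite_symb (hA : AddSubgroup.closure (Set.range A) = ⊤) {P : Module.End ℂ (RA A)}
    (hP : P ∈ DRA A) : {a | symb P a ≠ 0}.Finite := by
  obtain ⟨m, hm⟩ := hP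
  refine (IsOrderLE.finite_degrees hm).subset fun a ha => ?_
  by_contra hnot
  simp only [Set.mem_ofPred_eq, not_exists, not_not] at hnot
  exact ha (symb_eq hA ⟨m, hm⟩ a fun b hb => by rw [hnot ⟨b, hb⟩, map_zero])

/-- A symbol of degree `a` vanishes on the exponents which the degree `a` moves out of `ℕA`. -/
theorem eval_symb_eq_zero (hA : AddSubgroup.closure (Set.range A) = ⊤) {P : Module.End ℂ (RA A)}
    (hP : P ∈ DRA A) {a b : Fin d → ℤ} (hb : b ∈ NA A) (hab : a + b ∉ NA A) :
    MvPolynomial.eval (toC b) (symb P a) = 0 := by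
  rw [eval_symb hA hP a hb, cf_of_notMem hab]

theorem eval_symb_mul (hA : AddSubgroup.closure (Set.range A) = ⊤) {P Q : Module.End ℂ (RA A)}
    (hP : P ∈ DRA A) (hQ : Q ∈ DRA A) (a : Fin d → ℤ) (β : Fin d → ℂ) :
    MvPolynomial.eval β (symb (P * Q) a) = ∑ c ∈ (finite_symb hA hQ).toFinset,
      MvPolynomial.eval (β + toC c) (symb P (a - c)) * MvPolynomial.eval β (symb Q c) := by
  set T := (finite_symb hA hQ).toFinset
  have h : symb (P * Q) a = ∑ c ∈ T, shiftPoly (toC c) (symb P (a - c)) * symb Q c := by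
    refine symb_eq hA (mul_mem hP hQ) a fun b hb => ?_
    have hQb : Q (mon A b) = ∑ c ∈ T, MvPolynomial.eval (toC b) (symb Q c) • mon A (c + b) := by
      rw [eq_sum_cf_smul_mon (T.map (addRightEmbedding b)) (f := Q (mon A b))]
      · rw [Finset.sum_map]
        refine Finset.sum_congr rfl fun c _ => ?_
        rw [eval_symb hA hQ c hb]
        rfl
      · intro x hx
        refine Finset.mem_map.2 ⟨x - b, ?_, by simp⟩
        rw [Set.Finite.mem_toFinset]
        intro h0
        have := eval_symb hA hQ (x - b) hb
        rw [h0, map_zero, sub_add_cancel] at this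
        exact hx this.symm
    rw [Module.End.mul_apply, hQb, map_sum, map_sum, map_sum]
    refine Finset.sum_congr rfl fun c _ => ?_
    rw [map_smul, map_smul, map_mul, eval_shiftPoly, smul_eq_mul, mul_comm, ← toC_add]
    by_cases hcb : c + b ∈ NA A
    · rw [add_comm b c, eval_symb hA hP _ hcb]
      congr 2
      abel_nf
    · rw [eval_symb_eq_zero hA hQ hb hcb, mul_zero, mul_zero]
  rw [h, map_sum]
  refine Finset.sum_congr rfl fun c _ => ?_
  rw [map_mul, eval_shiftPoly]

end Symbols

/-! ### Ideals of operators vanishing on a convex set of exponents -/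

section ConvexIdeals

variable {d n : ℕ} {A : Fin n → Fin d → ℤ}

/-- If `t^a p(θ)` is a component of a differential operator and `p(β) ≠ 0`, then the degree `a`
cannot move `β` out of any of the sets `{F_σ ∈ F_σ(ℕA)}`: otherwise `p` would vanish on a translate
of `ℕA ∩ σ`, hence on the hyperplane through `β` parallel to `σ`. -/
theorem facetsPos_subset_of_eval_symb_ne_zero (hA : AddSubgroup.closure (Set.range A) = ⊤)
    {P : Module.End ℂ (RA A)} (hP : P ∈ DRA A) {a : Fin d → ℤ} {β : Fin d → ℂ}
    (h : MvPolynomial.eval β (symb P a) ≠ 0) : facetsPos A β ⊆ facetsPos A (β + toC a) := by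
  intro σ hσ
  by_contra hnot
  obtain ⟨s, hs, hsβ⟩ := (mem_facetsPos hA σ β).1 hσ
  refine h (eval_eq_zero_of_facet hA σ _ s (fun u hu hu0 => ?_) β hsβ)
  refine eval_symb_eq_zero hA hP (add_mem hs hu) fun hmem => hnot ?_
  refine (mem_facetsPos hA σ _).2 ⟨_, hmem, ?_⟩
  rw [suppC_add, suppC_toC hA, hsβ, map_add, map_add, hu0]
  push_cast
  ring

variable (A) in
/-- A set `V ⊆ ℂ^d` of exponents is convex if no two operators lead from `V` out of `V` and back.
Then the monomials with exponent in `V` span a subquotient of a module over `D(R_A)`. -/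
def IsOpConvex (V : Set (Fin d → ℂ)) : Prop :=
  ∀ P ∈ DRA A, ∀ Q ∈ DRA A, ∀ β ∈ V, ∀ a c : Fin d → ℤ, β + toC a ∈ V → β + toC c ∉ V →
    MvPolynomial.eval (β + toC c) (symb P (a - c)) * MvPolynomial.eval β (symb Q c) = 0

/-- The annihilator of the subquotient spanned by the monomials with exponent in `V`. -/
noncomputable def annIdeal (hA : AddSubgroup.closure (Set.range A) = ⊤) (V : Set (Fin d → ℂ))
    (hV : IsOpConvex A V) : TwoSidedIdeal (DRA A) :=
  TwoSidedIdeal.mk'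
    {P | ∀ β ∈ V, ∀ a : Fin d → ℤ, β + toC a ∈ V → MvPolynomial.eval β (symb P.1 a) = 0}
    (fun β _ a _ => by
      rw [show ((0 : DRA A) : Module.End ℂ (RA A)) = 0 from rfl, symb_zero hA, map_zero])
    (fun {x y} hx hy β hβ a ha => by
      rw [show ((x + y : DRA A) : Module.End ℂ (RA A)) = x.1 + y.1 from rfl,
        symb_add hA x.2 y.2, map_add, hx β hβ a ha, hy β hβ a ha, add_zero])
    (fun {x} hx β hβ a ha => by
      rw [show ((-x : DRA A) : Module.End ℂ (RA A)) = -x.1 from rfl,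
        symb_neg hA x.2, map_neg, hx β hβ a ha, neg_zero])
    (fun {x y} hy β hβ a ha => by
      rw [show ((x * y : DRA A) : Module.End ℂ (RA A)) = x.1 * y.1 from rfl,
        eval_symb_mul hA x.2 y.2]
      refine Finset.sum_eq_zero fun c _ => ?_
      by_cases hc : β + toC c ∈ V
      · rw [hy β hβ c hc, mul_zero]
      · exact hV _ x.2 _ y.2 β hβ a c ha hc)
    (fun {x y} hx β hβ a ha => by
      rw [show ((x * y : DRA A) : Module.End ℂ (RA A)) = x.1 * y.1 from rfl,
        eval_symb_mul hA x.2 y.2]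
      refine Finset.sum_eq_zero fun c _ => ?_
      by_cases hc : β + toC c ∈ V
      · rw [hx _ hc (a - c) (by rwa [add_assoc, ← toC_add, add_sub_cancel]), zero_mul]
      · exact hV _ x.2 _ y.2 β hβ a c ha hc)

theorem not_isSimpleRing_of_isOpConvex (hA : AddSubgroup.closure (Set.range A) = ⊤)
    {V : Set (Fin d → ℂ)} (hV : IsOpConvex A V) {β : Fin d → ℂ} (hβ : β ∈ V)
    {P : Module.End ℂ (RA A)} (hP : P ∈ DRA A) (hP0 : P ≠ 0)
    (h : ∀ β ∈ V, ∀ a : Fin d → ℤ, β + toC a ∈ V → MvPolynomial.eval β (symb P a) = 0) :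
    ¬ IsSimpleRing (DRA A) := by
  classical
  intro hsimple
  have hmem : (⟨P, hP⟩ : DRA A) ∈ annIdeal hA V hV := (TwoSidedIdeal.mem_mk' _ _ _ _ _ _ _).2 h
  have h1 := IsSimpleRing.one_mem_of_ne_zero_mem (annIdeal hA V hV)
    (x := (⟨P, hP⟩ : DRA A)) (fun h0 => hP0 (congrArg Subtype.val h0)) hmem
  have h2 := (TwoSidedIdeal.mem_mk' _ _ _ _ _ _ _).1 h1 β hβ 0 (by simpa using hβ)
  have h3 : symb ((1 : DRA A) : Module.End ℂ (RA A)) 0 = 1 :=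
    symb_eq hA (one_mem _) 0 fun b hb => by
      rw [zero_add, Module.End.one_apply, cf_mon hb, if_pos rfl, map_one]
  rw [h3, map_one] at h2
  exact one_ne_zero h2

theorem toC_injective : Function.Injective (toC : (Fin d → ℤ) → Fin d → ℂ) := by
  intro x y h
  funext i
  have := congrFun h i
  simpa [toC] using this

/-- If `D(R_A)` is simple then `ℕA` is scored: the lattice points of the scored closure that are
not in `ℕA` span a module over `D(R_A)`, which is annihilated by a monomial. -/
theorem isScored_of_isSimpleRing (hA : AddSubgroup.closure (Set.range A) = ⊤)
    (hsimple : IsSimpleRing (DRA A)) : IsScored A := by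
  classical
  rw [isScored_iff hA]
  by_contra! hnot
  obtain ⟨x₀, hx₀, hx₀A⟩ := hnot
  let V : Set (Fin d → ℂ) := {β | ∃ x : Fin d → ℤ, toC x = β ∧
    (∀ σ : Facet A, σ ∈ facetsPos A (toC x)) ∧ x ∉ NA A}
  have hV : IsOpConvex A V := by
    rintro P hP Q hQ _ ⟨x, rfl, hx, hxA⟩ a c ⟨y, hy, -, hyA⟩ hc
    rw [← toC_add] at hy hc ⊢
    obtain rfl := toC_injective hy
    by_contra hne
    obtain ⟨hne1, hne2⟩ := mul_ne_zero_iff.1 hne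
    have hpos := facetsPos_subset_of_eval_symb_ne_zero hA hQ hne2
    have hxc : x + c ∈ NA A := by
      by_contra h
      exact hc ⟨x + c, rfl, fun σ => by rw [toC_add]; exact hpos (hx σ), h⟩
    refine hne1 (eval_symb_eq_zero hA hP hxc ?_)
    rwa [show a - c + (x + c) = x + a by abel]
  obtain ⟨c, hc, hcond⟩ := exists_conductor hA
  have hvan : ∀ b ∈ NA A, c + b ∉ NA A → MvPolynomial.eval (toC b) (1 : MvPolynomial _ ℂ) = 0 :=
    fun b hb h => absurd (add_mem hc hb) h
  refine not_isSimpleRing_of_isOpConvex hA hV ⟨x₀, rfl, hx₀, hx₀A⟩ (tOp_mem hvan) ?_ ?_ hsimple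
  · intro h0
    have h1 := tOp_mon (A := A) c 1 (zero_mem (NA A))
    have h2 := congrArg (cf A c) h1
    rw [h0, map_one, one_smul, add_zero, cf_mon hc, if_pos rfl] at h2
    simp at h2
  · rintro _ ⟨x, rfl, hx, hxA⟩ a ⟨y, hy, -, hyA⟩
    rw [← toC_add] at hy
    obtain rfl := toC_injective hy
    rw [symb_tOp hA hvan, if_neg, map_zero]
    rintro rfl
    refine hyA ?_
    rw [add_comm]
    refine hcond x (mem_cone_of_supp_nonneg hA fun σ => ?_)
    obtain ⟨s, hs, hsx⟩ := (mem_facetsPos hA σ _).1 (hx σ)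
    rw [suppC_toC hA] at hsx
    rw [supp_toReal hA, show suppZ σ x = suppZ σ s by exact_mod_cast hsx]
    exact_mod_cast suppZ_nonneg hA σ hs

/-- The support function of a facet as a polynomial. -/
noncomputable def linPoly (σ : Facet A) : MvPolynomial (Fin d) ℂ :=
  ∑ i, MvPolynomial.C (suppVec σ i : ℂ) * MvPolynomial.X i

theorem eval_linPoly (hA : AddSubgroup.closure (Set.range A) = ⊤) (σ : Facet A)
    (β : Fin d → ℂ) : MvPolynomial.eval β (linPoly σ) = suppC A σ β := by
  simp [linPoly, suppC_apply hA]

theorem linPoly_sub_C_ne_zero (hA : AddSubgroup.closure (Set.range A) = ⊤) (σ : Facet A)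
    (z : ℂ) : linPoly σ - MvPolynomial.C z ≠ 0 := by
  intro h
  obtain ⟨x, hx⟩ := exists_suppZ_eq_one hA σ
  have h0 := congrArg (MvPolynomial.eval (toC 0)) h
  have h1 := congrArg (MvPolynomial.eval (toC x)) h
  rw [map_sub, eval_linPoly hA, suppC_toC hA, MvPolynomial.eval_C, map_zero] at h0 h1
  rw [hx] at h1
  simp only [map_zero, Int.cast_zero, zero_sub, neg_eq_zero, Int.cast_one] at h0 h1
  rw [h0] at h1
  simp at h1

/-- If the region of `α` is empty, then some support function that is integral at `α` takes only
finitely many values on the exponents equivalent to `α`. Each such function is bounded on one side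
there; if all were unbounded on the other side, a sum of witnesses would lie in the region. -/
theorem exists_suppZ_bounded (hA : AddSubgroup.closure (Set.range A) = ⊤) {α : Fin d → ℂ}
    (hα : ¬ (posRegion A α).Nonempty) :
    ∃ σ : Facet A, ∃ M : ℤ, ∀ b : Fin d → ℤ, facetsPos A (α + toC b) = facetsPos A α →
      |suppZ σ b| ≤ M := by
  classical
  cases nonempty_fintype (Facet A)
  by_contra! hunb
  let ε : Facet A → ℤ := fun σ => if σ ∈ facetsPos A α then 1 else -1
  have hε : ∀ σ, |ε σ| = 1 := fun σ => by simp only [ε]; split_ifs <;> simp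
  -- One-sided bounds, for the facets where the support function is integral at `α`.
  have hlow : ∀ σ : Facet A, ∃ L : ℤ, σ ∈ facetsPos A α ∨ σ ∈ facetsNeg A α →
      ∀ b : Fin d → ℤ, facetsPos A (α + toC b) = facetsPos A α → -L ≤ ε σ * suppZ σ b := by
    intro σ
    by_cases hpos : σ ∈ facetsPos A α
    · obtain ⟨s, hs, hsα⟩ := (mem_facetsPos hA σ α).1 hpos
      refine ⟨suppZ σ s, fun _ b hb => ?_⟩
      rw [← hb] at hpos
      obtain ⟨s', hs', hsα'⟩ := (mem_facetsPos hA σ _).1 hpos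
      rw [suppC_add, hsα, suppC_toC hA] at hsα'
      have h1 : suppZ σ s + suppZ σ b = suppZ σ s' := by exact_mod_cast hsα'
      have h2 := suppZ_nonneg hA σ hs'
      have h3 : ε σ = 1 := if_pos (hb ▸ hpos)
      rw [h3]; linarith
    · by_cases hneg : σ ∈ facetsNeg A α
      · obtain ⟨⟨z, hz⟩, -⟩ := (mem_facetsNeg σ α).1 hneg
        obtain ⟨N, hN⟩ := exists_forall_ge_mem_image hA σ
        refine ⟨N - z, fun _ b hb => ?_⟩
        have h3 : ε σ = -1 := if_neg hpos
        rw [h3]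
        by_contra hlt
        rw [← hb] at hpos
        obtain ⟨s, hs, hsm⟩ := hN (z + suppZ σ b) (by linarith)
        refine hpos ((mem_facetsPos hA σ _).2 ⟨s, hs, ?_⟩)
        rw [suppC_add, hz, suppC_toC hA, hsm]
        push_cast
        rfl
      · exact ⟨0, fun h => absurd h (by tauto)⟩
  choose L hL using hlow
  set K : ℤ := ∑ σ, |L σ| with hK
  have hLK : ∀ σ, L σ ≤ K := fun σ => (le_abs_self _).trans
    (Finset.single_le_sum (f := fun σ => |L σ|) (fun σ _ => abs_nonneg _) (Finset.mem_univ σ))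
  have hK0 : 0 ≤ K := Finset.sum_nonneg fun σ _ => abs_nonneg _
  choose b hb hbig using fun σ : Facet A => hunb σ ((Fintype.card (Facet A) + 1) * K)
  have key : ∀ τ : Facet A, τ ∈ facetsPos A α ∨ τ ∈ facetsNeg A α →
      0 < ε τ * suppZ τ (∑ σ, b σ) := by
    intro τ hτ
    have hother : ∀ σ, -K ≤ ε τ * suppZ τ (b σ) := fun σ =>
      (neg_le_neg (hLK τ)).trans (hL τ hτ _ (hb σ))
    have hself : (Fintype.card (Facet A) + 1) * K < ε τ * suppZ τ (b τ) := by
      have habs : |ε τ * suppZ τ (b τ)| = |suppZ τ (b τ)| := by rw [abs_mul, hε, one_mul]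
      have h1 := hbig τ
      rw [← habs] at h1
      rcases lt_abs.1 h1 with h | h
      · exact h
      · have := hother τ
        have hc : (0 : ℤ) ≤ Fintype.card (Facet A) := by positivity
        nlinarith
    have hcard : ((Finset.univ.erase τ).card : ℤ) ≤ Fintype.card (Facet A) := by
      exact_mod_cast Finset.card_le_univ _
    have hrest : -(Fintype.card (Facet A) * K) ≤
        ∑ σ ∈ Finset.univ.erase τ, ε τ * suppZ τ (b σ) := by
      have h1 := Finset.card_nsmul_le_sum (Finset.univ.erase τ)
        (fun σ => ε τ * suppZ τ (b σ)) (-K) fun σ _ => hother σ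
      rw [nsmul_eq_mul] at h1
      nlinarith
    rw [map_sum, Finset.mul_sum, ← Finset.add_sum_erase _ _ (Finset.mem_univ τ)]
    linarith
  refine hα ⟨toReal (∑ σ, b σ), fun σ hσ => ?_, fun σ hσ => ?_⟩
  · have h1 := key σ (Or.inl hσ)
    have h2 : ε σ = 1 := if_pos hσ
    rw [h2, one_mul] at h1
    rw [supp_toReal hA]
    exact_mod_cast h1
  · have h1 := key σ (Or.inr hσ)
    have h2 : ε σ = -1 := if_neg ((mem_facetsNeg σ α).1 hσ).2
    rw [h2] at h1
    rw [supp_toReal hA]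
    exact_mod_cast (by linarith : suppZ σ (∑ σ, b σ) < 0)

/-- If `D(R_A)` is simple then condition (C2) holds: if the region of `α` is empty, the exponents
equivalent to `α` lie on finitely many parallel hyperplanes, whose equation is an operator of degree
`0` annihilating the corresponding subquotient. -/
theorem conditionC2_of_isSimpleRing (hA : AddSubgroup.closure (Set.range A) = ⊤)
    (hsimple : IsSimpleRing (DRA A)) : ConditionC2 A := by
  classical
  by_contra hnot
  obtain ⟨α, hα⟩ := not_forall.1 hnot
  obtain ⟨σ, M, hM⟩ := exists_suppZ_bounded hA hα
  let V : Set (Fin d → ℂ) := {β | ∃ b : Fin d → ℤ, α + toC b = β ∧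
    facetsPos A β = facetsPos A α}
  have hV : IsOpConvex A V := by
    rintro P hP Q hQ _ ⟨b, rfl, hb⟩ a c ⟨b', hb', hpos⟩ hc
    by_contra hne
    obtain ⟨hne1, hne2⟩ := mul_ne_zero_iff.1 hne
    have h1 := facetsPos_subset_of_eval_symb_ne_zero hA hQ hne2
    have h2 := facetsPos_subset_of_eval_symb_ne_zero hA hP hne1
    rw [add_assoc (α + toC b), ← toC_add, add_sub_cancel, hpos] at h2
    rw [hb] at h1
    exact hc ⟨b + c, by rw [toC_add, add_assoc], h2.antisymm h1⟩
  let p : MvPolynomial (Fin d) ℂ :=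
    ∏ v ∈ Finset.Icc (-M) M, (linPoly σ - MvPolynomial.C (suppC A σ α + v))
  have hp : p ≠ 0 := Finset.prod_ne_zero_iff.2 fun v _ => linPoly_sub_C_ne_zero hA σ _
  have hvan : ∀ b ∈ NA A, 0 + b ∉ NA A → MvPolynomial.eval (toC b) p = 0 :=
    fun b hb h => absurd (by rwa [zero_add]) h
  refine not_isSimpleRing_of_isOpConvex hA hV (β := α) ⟨0, by simp, rfl⟩ (tOp_zero_mem p) ?_ ?_
    hsimple
  · intro h0
    have := symb_tOp hA hvan 0
    rw [h0, symb_zero hA, if_pos rfl] at this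
    exact hp this.symm
  · rintro _ ⟨b, rfl, hb⟩ a -
    rw [symb_tOp hA hvan]
    split_ifs
    · rw [map_prod]
      refine Finset.prod_eq_zero (i := suppZ σ b) (Finset.mem_Icc.2 (abs_le.1 (hM b hb))) ?_
      rw [map_sub, eval_linPoly hA, MvPolynomial.eval_C, suppC_add, suppC_toC hA, sub_self]
    · exact map_zero _

end ConvexIdeals

/-! ### Ideals of the ring of differential operators of a scored semigroup -/

section Simplicity

variable {d n : ℕ} {A : Fin n → Fin d → ℤ}

/-- The elements of `F_σ(ℕA)` which the degree `a` moves out of `F_σ(ℕA)`. -/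
def exitValues (σ : Facet A) (a : Fin d → ℤ) : Set ℤ :=
  {m | (∃ s ∈ NA A, suppZ σ s = m) ∧ ¬ ∃ s ∈ NA A, suppZ σ s = m + suppZ σ a}

theorem finite_exitValues (hA : AddSubgroup.closure (Set.range A) = ⊤) (σ : Facet A)
    (a : Fin d → ℤ) : (exitValues σ a).Finite := by
  obtain ⟨N, hN⟩ := exists_forall_ge_mem_image hA σ
  refine (Set.finite_Ico 0 (N - suppZ σ a)).subset ?_
  rintro m ⟨⟨s, hs, rfl⟩, h⟩
  refine ⟨suppZ_nonneg hA σ hs, ?_⟩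
  by_contra hlt
  exact h (hN _ (by linarith))

open Classical in
/-- The product of the equations `F_σ = m` of all hyperplanes which the degree `a` moves out of
the sets `{F_σ ∈ F_σ(ℕA)}`. -/
noncomputable def exitPoly (hA : AddSubgroup.closure (Set.range A) = ⊤) (a : Fin d → ℤ) :
    MvPolynomial (Fin d) ℂ :=
  letI := Fintype.ofFinite (Facet A)
  ∏ σ : Facet A, ∏ m ∈ (finite_exitValues hA σ a).toFinset, (linPoly σ - MvPolynomial.C (m : ℂ))

theorem eval_exitPoly_eq_zero_iff (hA : AddSubgroup.closure (Set.range A) = ⊤) (a : Fin d → ℤ)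
    (β : Fin d → ℂ) : MvPolynomial.eval β (exitPoly hA a) = 0 ↔
      ∃ σ : Facet A, σ ∈ facetsPos A β ∧ σ ∉ facetsPos A (β + toC a) := by
  simp only [exitPoly, map_prod, Finset.prod_eq_zero_iff, Finset.mem_univ, true_and,
    Set.Finite.mem_toFinset, map_sub, eval_linPoly hA, MvPolynomial.eval_C, sub_eq_zero,
    mem_facetsPos hA, suppC_add, suppC_toC hA]
  refine exists_congr fun σ => ⟨?_, ?_⟩
  · rintro ⟨m, ⟨⟨s, hs, rfl⟩, h⟩, hm⟩
    refine ⟨⟨s, hs, hm⟩, ?_⟩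
    rintro ⟨s', hs', h'⟩
    rw [hm] at h'
    exact h ⟨s', hs', by exact_mod_cast h'.symm⟩
  · rintro ⟨⟨s, hs, hm⟩, h⟩
    refine ⟨suppZ σ s, ⟨⟨s, hs, rfl⟩, ?_⟩, hm⟩
    rintro ⟨s', hs', h'⟩
    refine h ⟨s', hs', ?_⟩
    rw [hm, h']
    push_cast
    rfl

theorem mem_facetsPos_of_mem_NA (hA : AddSubgroup.closure (Set.range A) = ⊤) {x : Fin d → ℤ}
    (hx : x ∈ NA A) (σ : Facet A) : σ ∈ facetsPos A (toC x) :=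
  (mem_facetsPos hA σ _).2 ⟨x, hx, suppC_toC hA σ x⟩

theorem eval_exitPoly_eq_zero (hA : AddSubgroup.closure (Set.range A) = ⊤) (hS : IsScored A)
    (a : Fin d → ℤ) : ∀ b ∈ NA A, a + b ∉ NA A → MvPolynomial.eval (toC b) (exitPoly hA a) = 0 := by
  intro b hb hab
  rw [eval_exitPoly_eq_zero_iff]
  by_contra! h
  refine hab ((isScored_iff hA).1 hS _ fun σ => ?_)
  rw [add_comm, toC_add]
  exact h σ (mem_facetsPos_of_mem_NA hA hb σ)

theorem cf_tOp_zero (p : MvPolynomial (Fin d) ℂ) (x : Fin d → ℤ) (g : RA A) :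
    cf A x (tOp A 0 p g) = MvPolynomial.eval (toC x) p * cf A x g := by
  classical
  have : cf A x ∘ₗ tOp A 0 p = MvPolynomial.eval (toC x) p • cf A x := by
    refine linearMap_ext_mon fun y hy => ?_
    rw [LinearMap.comp_apply, tOp_mon _ _ hy, zero_add, map_smul, LinearMap.smul_apply, cf_mon hy]
    split_ifs with h
    · rw [h]
    · simp
  exact LinearMap.congr_fun this g

theorem tOp_zero_mul (p q : MvPolynomial (Fin d) ℂ) :
    tOp A 0 (p * q) = tOp A 0 p * tOp A 0 q := by
  refine LinearMap.ext fun g => ext_cf fun x _ => ?_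
  rw [Module.End.mul_apply, cf_tOp_zero, cf_tOp_zero, cf_tOp_zero, map_mul, mul_assoc]

theorem tOp_zero_add (p q : MvPolynomial (Fin d) ℂ) :
    tOp A 0 (p + q) = tOp A 0 p + tOp A 0 q := by
  refine LinearMap.ext fun g => ext_cf fun x _ => ?_
  rw [LinearMap.add_apply, map_add, cf_tOp_zero, cf_tOp_zero, cf_tOp_zero, map_add, add_mul]

theorem tOp_zero_zero : tOp A 0 0 = 0 := by
  refine LinearMap.ext fun g => ext_cf fun x _ => ?_
  rw [cf_tOp_zero, map_zero, zero_mul, LinearMap.zero_apply, map_zero]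

theorem tOp_zero_one : tOp A 0 1 = 1 := by
  refine LinearMap.ext fun g => ext_cf fun x _ => ?_
  rw [cf_tOp_zero, map_one, one_mul, Module.End.one_apply]

/-- The operator `θ_i` is a derivation of `R_A`. -/
theorem mulOp_tOp_X (i : Fin d) (g : RA A) :
    mulOp (tOp A 0 (MvPolynomial.X i) g) =
      tOp A 0 (MvPolynomial.X i) * mulOp g - mulOp g * tOp A 0 (MvPolynomial.X i) := by
  refine linearMap_ext_mon fun y hy => ?_
  simp only [LinearMap.sub_apply, Module.End.mul_apply, LinearMap.mulLeft_apply]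
  rw [eq_sub_iff_add_eq]
  induction g using RA_induction with
  | zero => simp
  | add f g hf hg =>
    rw [map_add, add_mul, add_mul, add_mul, map_add, ← hf, ← hg]
    abel
  | smul c x hx =>
    rw [map_smul, smul_mul_assoc, smul_mul_assoc, smul_mul_assoc, map_smul, mon_mul_mon hx hy,
      tOp_mon _ _ hx, tOp_mon _ _ hy, tOp_mon _ _ (add_mem hx hy), zero_add, zero_add, zero_add,
      smul_mul_assoc, mul_smul_comm, mon_mul_mon hx hy, ← smul_add, ← add_smul]
    simp [toC]

theorem exists_int_point (hA : AddSubgroup.closure (Set.range A) = ⊤) {α : Fin d → ℂ}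
    (hα : (posRegion A α).Nonempty) (K : Facet A → ℤ) :
    ∃ b : Fin d → ℤ, (∀ σ ∈ facetsPos A α, K σ ≤ suppZ σ b) ∧
      ∀ σ ∈ facetsNeg A α, suppZ σ b ≤ -K σ := by
  obtain ⟨γ, hpos, hneg⟩ := hα
  -- Rounding a large multiple of `γ` changes the support functions by a bounded amount.
  have hround : ∀ (σ : Facet A) (t : ℝ),
      |(suppZ σ (fun i => ⌊t * γ i⌋) : ℝ) - t * supp A σ γ| ≤ ∑ i, |(suppVec σ i : ℝ)| := by
    intro σ t
    rw [suppZ_apply, supp_apply hA, Finset.mul_sum]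
    push_cast
    rw [← Finset.sum_sub_distrib]
    refine (Finset.abs_sum_le_sum_abs _ _).trans (Finset.sum_le_sum fun i _ => ?_)
    have h1 : (suppVec σ i : ℝ) * ⌊t * γ i⌋ - t * (suppVec σ i * γ i) =
        suppVec σ i * (⌊t * γ i⌋ - t * γ i) := by ring
    rw [h1, abs_mul]
    refine mul_le_of_le_one_right (abs_nonneg _) ?_
    have h2 := Int.floor_le (t * γ i)
    have h3 := Int.lt_floor_add_one (t * γ i)
    rw [abs_le]
    constructor <;> linarith
  have hev : ∀ᶠ t : ℝ in Filter.atTop, ∀ σ : Facet A,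
      (σ ∈ facetsPos A α → K σ ≤ suppZ σ (fun i => ⌊t * γ i⌋)) ∧
      (σ ∈ facetsNeg A α → suppZ σ (fun i => ⌊t * γ i⌋) ≤ -K σ) := by
    rw [Filter.eventually_all]
    intro σ
    refine Filter.Eventually.and ?_ ?_
    · by_cases hσ : σ ∈ facetsPos A α
      · have hlim := Filter.Tendsto.atTop_mul_const (hpos σ hσ) Filter.tendsto_id
        filter_upwards [hlim.eventually_ge_atTop (K σ + ∑ i, |(suppVec σ i : ℝ)|)] with t ht _
        have := (abs_le.1 (hround σ t)).1
        simp only [id] at ht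
        exact_mod_cast (by linarith : (K σ : ℝ) ≤ suppZ σ (fun i => ⌊t * γ i⌋))
      · exact Filter.Eventually.of_forall fun t h => absurd h hσ
    · by_cases hσ : σ ∈ facetsNeg A α
      · have hlim := Filter.Tendsto.atTop_mul_const (neg_pos.2 (hneg σ hσ)) Filter.tendsto_id
        filter_upwards [hlim.eventually_ge_atTop (K σ + ∑ i, |(suppVec σ i : ℝ)|)] with t ht _
        have := (abs_le.1 (hround σ t)).2
        simp only [id] at ht
        exact_mod_cast (by linarith : (suppZ σ (fun i => ⌊t * γ i⌋) : ℝ) ≤ -K σ)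
      · exact Filter.Eventually.of_forall fun t h => absurd h hσ
  obtain ⟨t, ht⟩ := hev.exists
  exact ⟨_, fun σ hσ => (ht σ).1 hσ, fun σ hσ => (ht σ).2 hσ⟩

/-- Moving `α` out by a suitable degree `b`, multiplying by `t^c` and moving back gives an operator
of degree `0` that does not vanish at `α`. -/
theorem exists_exitPoly_ne_zero (hA : AddSubgroup.closure (Set.range A) = ⊤)
    (hC : ConditionC2 A) (α : Fin d → ℂ) (c : Fin d → ℤ) :
    ∃ b : Fin d → ℤ, MvPolynomial.eval α (exitPoly hA b) ≠ 0 ∧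
      MvPolynomial.eval (α + toC (b + c)) (exitPoly hA (-(b + c))) ≠ 0 := by
  choose N hN using fun σ : Facet A => exists_forall_ge_mem_image hA σ
  obtain ⟨b, hpos, hneg⟩ := exists_int_point hA (hC α)
    fun σ => max (N σ) (⌊(suppC A σ α).re⌋ + suppZ σ c + 1)
  refine ⟨b, ?_, ?_⟩
  · rw [Ne, eval_exitPoly_eq_zero_iff]
    rintro ⟨σ, hσ, hσ'⟩
    obtain ⟨s, hs, hsα⟩ := (mem_facetsPos hA σ α).1 hσ
    have h1 := (le_max_left _ _).trans (hpos σ hσ)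
    have h2 := suppZ_nonneg hA σ hs
    obtain ⟨s', hs', h'⟩ := hN σ (suppZ σ s + suppZ σ b) (by linarith)
    refine hσ' ((mem_facetsPos hA σ _).2 ⟨s', hs', ?_⟩)
    rw [suppC_add, hsα, suppC_toC hA, h']
    push_cast
    rfl
  · rw [Ne, eval_exitPoly_eq_zero_iff]
    rintro ⟨σ, hσ, hσ'⟩
    rw [toC_neg, add_neg_cancel_right] at hσ'
    obtain ⟨s, hs, hsα⟩ := (mem_facetsPos hA σ _).1 hσ
    rw [suppC_add, suppC_toC hA] at hsα
    have hz : suppC A σ α = ((suppZ σ s - suppZ σ (b + c) : ℤ) : ℂ) := by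
      push_cast
      rw [← hsα]; ring
    have hfl : ⌊(suppC A σ α).re⌋ = suppZ σ s - suppZ σ (b + c) := by
      rw [hz, Complex.intCast_re, Int.floor_intCast]
    have h1 := hneg σ ((mem_facetsNeg σ α).2 ⟨⟨_, hz⟩, hσ'⟩)
    have h2 := suppZ_nonneg hA σ hs
    have h3 := le_max_right (N σ) (⌊(suppC A σ α).re⌋ + suppZ σ c + 1)
    rw [hfl, map_add] at h3 h1
    linarith

theorem tOp_mul_mon_mul_tOp {b c : Fin d → ℤ} (hc : c ∈ NA A) {p q : MvPolynomial (Fin d) ℂ}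
    (hp : ∀ x ∈ NA A, b + x ∉ NA A → MvPolynomial.eval (toC x) p = 0) :
    tOp A (-(b + c)) q * (mulOp (mon A c) * tOp A b p) =
      tOp A 0 (p * shiftPoly (toC (b + c)) q) := by
  refine linearMap_ext_mon fun x hx => ?_
  rw [Module.End.mul_apply, Module.End.mul_apply, tOp_mon _ _ hx, tOp_mon _ _ hx, map_mul,
    eval_shiftPoly, map_smul, map_smul, LinearMap.mulLeft_apply]
  by_cases hbx : b + x ∈ NA A
  · rw [mon_mul_mon hc hbx, tOp_mon _ _ (add_mem hc hbx), smul_smul, ← toC_add,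
      show c + (b + x) = x + (b + c) by abel, show -(b + c) + (x + (b + c)) = 0 + x by abel]
  · rw [hp x hx hbx, zero_mul, zero_smul, zero_smul]

variable (J : TwoSidedIdeal (DRA A))

/-- The operators that belong to the two-sided ideal `J` of `D(R_A)`. -/
def InIdeal (P : Module.End ℂ (RA A)) : Prop := ∃ h : P ∈ DRA A, (⟨P, h⟩ : DRA A) ∈ J

variable {J}

theorem InIdeal.mul_left {P Q : Module.End ℂ (RA A)} (hP : P ∈ DRA A) (hQ : InIdeal J Q) :
    InIdeal J (P * Q) :=
  ⟨mul_mem hP hQ.1, J.mul_mem_left ⟨P, hP⟩ _ hQ.2⟩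

theorem InIdeal.mul_right {P Q : Module.End ℂ (RA A)} (hQ : Q ∈ DRA A) (hP : InIdeal J P) :
    InIdeal J (P * Q) :=
  ⟨mul_mem hP.1 hQ, J.mul_mem_right _ ⟨Q, hQ⟩ hP.2⟩

theorem InIdeal.add {P Q : Module.End ℂ (RA A)} (hP : InIdeal J P) (hQ : InIdeal J Q) :
    InIdeal J (P + Q) := ⟨add_mem hP.1 hQ.1, J.add_mem hP.2 hQ.2⟩

theorem InIdeal.smul {P : Module.End ℂ (RA A)} (c : ℂ) (hP : InIdeal J P) :
    InIdeal J (c • P) := by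
  rw [Algebra.smul_def]
  exact InIdeal.mul_left (Subalgebra.algebraMap_mem _ c) hP

theorem InIdeal.sub {P Q : Module.End ℂ (RA A)} (hP : InIdeal J P) (hQ : InIdeal J Q) :
    InIdeal J (P - Q) := by
  rw [sub_eq_add_neg, ← neg_one_smul ℂ Q]
  exact hP.add (hQ.smul _)

/-- Commutators lower the order, so that a nonzero ideal contains a nonzero element of `R_A`. -/
theorem exists_inIdeal_mulOp {m : ℕ} {P : Module.End ℂ (RA A)} (hm : IsOrderLE A m P)
    (hP : InIdeal J P) (hP0 : P ≠ 0) : ∃ g, g ≠ 0 ∧ InIdeal J (mulOp g) := by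
  have hzero : ∀ P : Module.End ℂ (RA A), (∀ g, br g P = 0) → P ≠ 0 → InIdeal J P →
      ∃ g, g ≠ 0 ∧ InIdeal J (mulOp g) := by
    intro P h hP0 hP
    have hPm : P = mulOp (P 1) := by
      refine LinearMap.ext fun f => ?_
      have := LinearMap.congr_fun (h f) 1
      rw [br_apply, mul_one, LinearMap.zero_apply, sub_eq_zero] at this
      rw [LinearMap.mulLeft_apply, mul_comm, this]
    refine ⟨P 1, fun h1 => hP0 ?_, hPm ▸ hP⟩
    rw [hPm, h1]
    exact LinearMap.ext fun f => zero_mul f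
  induction m generalizing P with
  | zero => exact hzero P (isOrderLE_zero_iff.1 hm) hP0 hP
  | succ m ih =>
    by_cases h : ∀ g, br g P = 0
    · exact hzero P h hP0 hP
    · push Not at h
      obtain ⟨g, hg⟩ := h
      exact ih (isOrderLE_succ_iff.1 hm g)
        ((hP.mul_left (mulOp_mem g)).sub (hP.mul_right (mulOp_mem g))) hg

/-- The derivations `θ_i` separate the monomials of an element of `R_A`, so that the ideal contains
a monomial. -/
theorem exists_inIdeal_mon {g : RA A} (hg : g ≠ 0) (hJ : InIdeal J (mulOp g)) :
    ∃ c ∈ NA A, InIdeal J (mulOp (mon A c)) := by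
  classical
  induction hN : (finite_cf g).toFinset.card using Nat.strong_induction_on generalizing g with
  | _ N ih =>
  obtain ⟨x, hx⟩ : ∃ x, cf A x g ≠ 0 := by
    by_contra! h
    exact hg (ext_cf fun x _ => by rw [h x, map_zero])
  have hxS : x ∈ NA A := by
    by_contra h
    exact hx (cf_of_notMem h g)
  by_cases hone : ∀ y, cf A y g ≠ 0 → y = x
  · refine ⟨x, hxS, ?_⟩
    have h1 : g = cf A x g • mon A x := by
      have := eq_sum_cf_smul_mon (f := g) {x} fun y hy => Finset.mem_singleton.2 (hone y hy)
      rwa [Finset.sum_singleton] at this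
    have h2 : mulOp (mon A x) = (cf A x g)⁻¹ • mulOp g := by
      refine LinearMap.ext fun f => ?_
      rw [LinearMap.smul_apply, LinearMap.mulLeft_apply, LinearMap.mulLeft_apply,
        ← smul_mul_assoc]
      congr 1
      rw [eq_inv_smul_iff₀ hx, ← h1]
    rw [h2]
    exact hJ.smul _
  · push Not at hone
    obtain ⟨y, hy, hyx⟩ := hone
    obtain ⟨i, hi⟩ := Function.ne_iff.1 hyx
    set θ := tOp A 0 (MvPolynomial.X i)
    set g' : RA A := θ g - (x i : ℂ) • g with hg'
    have hcf : ∀ z, cf A z g' = ((z i : ℂ) - x i) * cf A z g := by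
      intro z
      rw [hg', map_sub, cf_tOp_zero, map_smul, MvPolynomial.eval_X, smul_eq_mul, sub_mul]
      rfl
    have hJ' : InIdeal J (mulOp g') := by
      have h1 : mulOp g' = (θ * mulOp g - mulOp g * θ) - (x i : ℂ) • mulOp g := by
        rw [← mulOp_tOp_X]
        refine LinearMap.ext fun f => ?_
        simp only [LinearMap.sub_apply, LinearMap.smul_apply, LinearMap.mulLeft_apply, hg',
          sub_mul, smul_mul_assoc, θ]
      rw [h1]
      exact ((hJ.mul_left (tOp_zero_mem _)).sub (hJ.mul_right (tOp_zero_mem _))).sub (hJ.smul _)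
    have hyg' : cf A y g' ≠ 0 := by
      rw [hcf]
      refine mul_ne_zero (sub_ne_zero.2 ?_) hy
      exact_mod_cast hi
    refine ih _ ?_ (g := g') ?_ hJ' rfl
    · rw [← hN]
      refine Finset.card_lt_card ⟨fun z hz => ?_, fun h => ?_⟩
      · rw [Set.Finite.mem_toFinset, Set.mem_ofPred_eq] at hz ⊢
        rw [hcf] at hz
        exact right_ne_zero_of_mul hz
      · have hx' : x ∈ (finite_cf g).toFinset := by
          rw [Set.Finite.mem_toFinset]; exact hx
        have := h hx'
        rw [Set.Finite.mem_toFinset, Set.mem_ofPred_eq, hcf, sub_self, zero_mul] at this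
        exact this rfl
    · rintro h0
      rw [h0, map_zero] at hyg'
      exact hyg' rfl

/-- The polynomials `p` such that `p(θ)` belongs to the ideal `J`. -/
noncomputable def degreeZeroIdeal (J : TwoSidedIdeal (DRA A)) :
    Ideal (MvPolynomial (Fin d) ℂ) where
  carrier := {p | InIdeal J (tOp A 0 p)}
  zero_mem' := by
    rw [Set.mem_ofPred_eq, tOp_zero_zero]
    exact ⟨zero_mem _, J.zero_mem⟩
  add_mem' {p q} hp hq := by
    rw [Set.mem_ofPred_eq, tOp_zero_add]
    exact InIdeal.add hp hq
  smul_mem' p q hq := by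
    rw [Set.mem_ofPred_eq, smul_eq_mul, tOp_zero_mul]
    exact InIdeal.mul_left (tOp_zero_mem p) hq

/-- An ideal containing a monomial contains, for every `α`, an operator `p(θ)` with `p(α) ≠ 0`, hence
by the Nullstellensatz the identity. -/
theorem one_mem_of_inIdeal_mon (hA : AddSubgroup.closure (Set.range A) = ⊤) (hS : IsScored A)
    (hC : ConditionC2 A) {c : Fin d → ℤ} (hc : c ∈ NA A) (hJ : InIdeal J (mulOp (mon A c))) :
    (1 : DRA A) ∈ J := by
  have hempty : MvPolynomial.zeroLocus ℂ (degreeZeroIdeal J) = ∅ := by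
    refine Set.eq_empty_iff_forall_notMem.2 fun α hα => ?_
    obtain ⟨b, hb1, hb2⟩ := exists_exitPoly_ne_zero hA hC α c
    have hmem : exitPoly hA b * shiftPoly (toC (b + c)) (exitPoly hA (-(b + c))) ∈
        degreeZeroIdeal J := by
      change InIdeal J _
      rw [← tOp_mul_mon_mul_tOp hc (eval_exitPoly_eq_zero hA hS b)]
      exact (hJ.mul_right (tOp_mem (eval_exitPoly_eq_zero hA hS b))).mul_left
        (tOp_mem (eval_exitPoly_eq_zero hA hS _))
    have h0 := hα _ hmem
    rw [MvPolynomial.aeval_eq_eval, map_mul] at h0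
    exact mul_ne_zero hb1 (by rwa [eval_shiftPoly]) h0
  have htop : degreeZeroIdeal J = ⊤ := by
    rw [← Ideal.radical_eq_top, ← MvPolynomial.vanishingIdeal_zeroLocus_eq_radical (K := ℂ),
      hempty, MvPolynomial.vanishingIdeal_empty]
  have h1 : (1 : MvPolynomial (Fin d) ℂ) ∈ degreeZeroIdeal J := by rw [htop]; trivial
  have h2 : InIdeal J (tOp A 0 1) := h1
  rw [tOp_zero_one] at h2
  exact h2.2

theorem isSimpleRing_of_isScored (hA : AddSubgroup.closure (Set.range A) = ⊤) (hS : IsScored A)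
    (hC : ConditionC2 A) : IsSimpleRing (DRA A) := by
  have : Nontrivial (DRA A) := by
    refine ⟨0, 1, fun h => ?_⟩
    have h1 := LinearMap.congr_fun (congrArg Subtype.val h) (1 : RA A)
    exact zero_ne_one (α := RA A) h1
  refine ⟨⟨fun J => ?_⟩⟩
  by_cases hJ : J = ⊥
  · exact Or.inl hJ
  right
  obtain ⟨⟨P, hPD⟩, hPJ, hP0⟩ : ∃ P : DRA A, P ∈ J ∧ P ≠ 0 := by
    by_contra! h
    refine hJ (TwoSidedIdeal.ext fun x => ?_)
    rw [TwoSidedIdeal.mem_bot]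
    exact ⟨h x, fun h => h ▸ J.zero_mem⟩
  obtain ⟨m, hm⟩ := hPD
  obtain ⟨g, hg, hgJ⟩ := exists_inIdeal_mulOp hm ⟨⟨m, hm⟩, hPJ⟩ fun h => hP0 (Subtype.ext h)
  obtain ⟨c, hc, hcJ⟩ := exists_inIdeal_mon hg hgJ
  exact J.one_mem_iff.1 (one_mem_of_inIdeal_mon hA hS hC hc hcJ)

end Simplicity

end AffineToric

theorem mainTheorem3 {d n : ℕ} (A : Fin n → Fin d → ℤ)
    (hA : AddSubgroup.closure (Set.range A) = ⊤) :
    IsSimpleRing (AffineToric.DRA A) ↔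
      AffineToric.IsScored A ∧ AffineToric.ConditionC2 A :=
  ⟨fun h => ⟨AffineToric.isScored_of_isSimpleRing hA h,
    AffineToric.conditionC2_of_isSimpleRing hA h⟩,
    fun h => AffineToric.isSimpleRing_of_isScored hA h.1 h.2⟩
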